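/- Let $G$ be a compact Lie group and let $\Sigma$ be a smooth $G$-cone with compact base $X$: that is, $X$ is a compact (finite-dimensional, Hausdorff) smooth manifold, possibly with boundary, $\Sigma\to X$ is a smooth principal bundle for the multiplicative group $\mathbb{R}_{>0}$ (whose action on $\Sigma$, $(t,x)\mapsto t\cdot x$, is called the action by homotheties), and $G$ acts smoothly on $\Sigma$ and commutes with homotheties. Let $\rho$ be the radial vector field $\rho(x)=\frac{d}{dt}\big|_{t=1}\,t\cdot x$. Let $\lambda$ be a smooth real $G$-invariant 1-form on $\Sigma$ which is horizontal and homogeneous of degree 1, i.e. $\rho\lrcorner\lambda=0$ and $L_\rho\lambda=\lambda$. Then there exist a finite-dimensional continuous real orthogonal representation $V\cong\mathbb{R}^n$ of $G$ and a smooth embedding $z:\Sigma\to V^c\cong\mathbb{C}^n$ into its complexification $V^c=V\otimes_{\mathbb{R}}\mathbb{C}$ (a unitary representation of $G$) such that $z$ is $G$-equivariant, $z(g\cdot x)=g\,z(x)$ for all $g\in G$; $z$ is homogeneous of degree $\tfrac12$, $z(t\cdot x)=t^{1/2}z(x)$ for all $t>0$; and $$\lambda=\operatorname{Im}\,\bar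 z\cdot dz=\operatorname{Im}\sum_{j=1}^n\bar z_j\,dz_j .$$ -/

import Mathlib

open Set Topology
open scoped Manifold ContDiff Bundle

noncomputable section

/-- A smooth cone `S` with base `X`: a smooth principal bundle `S → X` for the multiplicative group
of positive real numbers. `dil t` is the homothety of ratio `t`; its values for `t ≤ 0` are
irrelevant. The last field is smooth equivariant local triviality: near every point of the base the
bundle is `U × (0, ∞)` with homotheties acting by multiplication on the second factor. -/
structure SmoothCone
    {ES : Type*} [NormedAddCommGroup ES] [NormedSpace ℝ ES] {HS : Type*} [TopologicalSpace HS]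
    (IS : ModelWithCorners ℝ ES HS)
    {EX : Type*} [NormedAddCommGroup EX] [NormedSpace ℝ EX] {HX : Type*} [TopologicalSpace HX]
    (IX : ModelWithCorners ℝ EX HX)
    (S : Type*) [TopologicalSpace S] [ChartedSpace HS S]
    (X : Type*) [TopologicalSpace X] [ChartedSpace HX X] where
  proj : S → X
  dil : ℝ → S → S
  contMDiff_proj : ContMDiff IS IX ∞ proj
  contMDiffOn_dil : ContMDiffOn (𝓘(ℝ, ℝ).prod IS) IS ∞ (fun q : ℝ × S => dil q.1 q.2)
    (Ioi 0 ×ˢ univ)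
  dil_one : ∀ x, dil 1 x = x
  dil_mul : ∀ s t, 0 < s → 0 < t → ∀ x, dil (s * t) x = dil s (dil t x)
  proj_dil : ∀ t, 0 < t → ∀ x, proj (dil t x) = proj x
  exists_trivialization : ∀ b : X, ∃ (U : Set X) (φ : OpenPartialHomeomorph S (X × ℝ)),
    IsOpen U ∧ b ∈ U ∧ φ.source = proj ⁻¹' U ∧ φ.target = U ×ˢ Ioi 0 ∧
    ContMDiffOn IS (IX.prod 𝓘(ℝ, ℝ)) ∞ φ φ.source ∧
    ContMDiffOn (IX.prod 𝓘(ℝ, ℝ)) IS ∞ φ.symm φ.target ∧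
    ∀ x ∈ φ.source, (φ x).1 = proj x ∧ ∀ t, 0 < t → φ (dil t x) = (proj x, t * (φ x).2)

/-- Smooth real 1-forms on `S`: smooth sections of the cotangent bundle. -/
abbrev SmoothOneForm
    {ES : Type*} [NormedAddCommGroup ES] [NormedSpace ℝ ES] {HS : Type*} [TopologicalSpace HS]
    (IS : ModelWithCorners ℝ ES HS)
    (S : Type*) [TopologicalSpace S] [ChartedSpace HS S] [IsManifold IS ∞ S] :=
  ContMDiffSection IS (ES →L[ℝ] ℝ) ∞
    (fun x : S => TangentSpace IS x →L[ℝ] Bundle.Trivial S ℝ x)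

/-- The pullback `f^* w`, as a family of covectors, evaluated at `x` on the tangent vector `v`. -/
def pullbackOneForm
    {ES : Type*} [NormedAddCommGroup ES] [NormedSpace ℝ ES] {HS : Type*} [TopologicalSpace HS]
    {IS : ModelWithCorners ℝ ES HS}
    {S : Type*} [TopologicalSpace S] [ChartedSpace HS S] [IsManifold IS ∞ S]
    (f : S → S) (w : SmoothOneForm IS S) (x : S) (v : TangentSpace IS x) : ℝ :=
  w (f x) (mfderiv IS IS f x v)

namespace SmoothCone

variable
    {ES : Type*} [NormedAddCommGroup ES] [NormedSpace ℝ ES] {HS : Type*} [TopologicalSpace HS]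
    {IS : ModelWithCorners ℝ ES HS}
    {EX : Type*} [NormedAddCommGroup EX] [NormedSpace ℝ EX] {HX : Type*} [TopologicalSpace HX]
    {IX : ModelWithCorners ℝ EX HX}
    {S : Type*} [TopologicalSpace S] [ChartedSpace HS S]
    {X : Type*} [TopologicalSpace X] [ChartedSpace HX X]

/-- The radial vector field `ρ`: the velocity at `t = 1` of `t ↦ dil t x`. (This velocity is a
tangent vector at `dil 1 x`, which is the point `x`.) -/
def radialField (C : SmoothCone IS IX S X) (x : S) : TangentSpace IS x :=
  cast (congrArg (fun y : S => TangentSpace IS y) (C.dil_one x))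
    (mfderiv 𝓘(ℝ, ℝ) IS (fun t : ℝ => C.dil t x) 1 (1 : ℝ))

variable [IsManifold IS ∞ S]

/-- A 1-form is horizontal if its contraction with the radial vector field vanishes. -/
def IsHorizontal (C : SmoothCone IS IX S X) (w : SmoothOneForm IS S) : Prop :=
  ∀ x : S, w x (C.radialField x) = 0

/-- `L_ρ w = η`, where `L_ρ` is the Lie derivative along the radial vector field `ρ`, i.e. the
derivative at time `0` of the pullback under the flow of `ρ`, which is `s ↦ dil (exp s)`. -/
def HasRadialLieDeriv (C : SmoothCone IS IX S X) (w η : SmoothOneForm IS S) : Prop :=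
  ∀ (x : S) (v : TangentSpace IS x),
    HasDerivAt (fun s : ℝ => pullbackOneForm (C.dil (Real.exp s)) w x v) (η x v) 0

end SmoothCone

/-- The complexification of a real orthogonal representation on `ℝⁿ` (in matrix form): the same
matrices, acting unitarily on `ℂⁿ`. -/
def complexifyRep {G : Type*} [Group G] {n : ℕ} (rep : G →* Matrix.orthogonalGroup (Fin n) ℝ) :
    G →* Matrix.unitaryGroup (Fin n) ℂ where
  toFun g := ⟨(rep g : Matrix (Fin n) (Fin n) ℝ).map Complex.ofReal, by
    have h := (Matrix.mem_orthogonalGroup_iff (Fin n) ℝ).1 (rep g).2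
    rw [Matrix.mem_unitaryGroup_iff]
    have h2 : star ((rep g : Matrix (Fin n) (Fin n) ℝ).map Complex.ofReal)
        = (star (rep g : Matrix (Fin n) (Fin n) ℝ)).map Complex.ofReal := by
      ext i j; simp [Matrix.star_apply]
    rw [h2]
    have h3 := congrArg (fun M : Matrix (Fin n) (Fin n) ℝ => Complex.ofRealHom.mapMatrix M) h
    simp only [map_mul, map_one] at h3
    exact h3⟩
  map_one' := by
    ext i j; simp [Matrix.one_apply, apply_ite Complex.ofReal]
  map_mul' g h := by
    apply Subtype.ext
    rw [map_mul]
    exact Complex.ofRealHom.mapMatrix.map_mul (rep g : Matrix (Fin n) (Fin n) ℝ) (rep h).1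

/-- A smooth embedding of a manifold `S` into a finite-dimensional real normed space: a smooth map
that is a homeomorphism onto its image and whose differential is injective at every point. -/
def IsSmoothEmbeddingInto
    {ES : Type*} [NormedAddCommGroup ES] [NormedSpace ℝ ES] {HS : Type*} [TopologicalSpace HS]
    (IS : ModelWithCorners ℝ ES HS)
    {S : Type*} [TopologicalSpace S] [ChartedSpace HS S]
    {V : Type*} [NormedAddCommGroup V] [NormedSpace ℝ V] (z : S → V) : Prop :=
  ContMDiff IS 𝓘(ℝ, V) ∞ z ∧ IsEmbedding z ∧ ∀ x, Function.Injective (mfderiv IS 𝓘(ℝ, V) z x)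

/-- The value at `x` on `v` of the 1-form `Im z̄ · dz`, where `z` maps `S` to `ℂⁿ`. -/
def imConjDot
    {ES : Type*} [NormedAddCommGroup ES] [NormedSpace ℝ ES] {HS : Type*} [TopologicalSpace HS]
    (IS : ModelWithCorners ℝ ES HS)
    {S : Type*} [TopologicalSpace S] [ChartedSpace HS S] {n : ℕ}
    (z : S → EuclideanSpace ℂ (Fin n)) (x : S) (v : TangentSpace IS x) : ℝ :=
  let dz : EuclideanSpace ℂ (Fin n) := mfderiv IS 𝓘(ℝ, EuclideanSpace ℂ (Fin n)) z x v
  (∑ j, starRingEnd ℂ (z x j) * dz j).im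

end

/-!
Averaging over `G` gives a positive invariant function `r` of degree one on `Σ`. An embedding of
`X` in a Euclidean space, together with `r`, is an injective immersion of `Σ`. By the Peter–Weyl
theorem the integrals of this embedding along the orbits, weighted by elements of
finite-dimensional invariant subspaces of `L²(G)`, separate points and tangent vectors; since
`{r = 1}` is compact, one such subspace suffices. This makes the embedding into an equivariant map
`w` of degree zero with `(r, w)` still an injective immersion.

As `λ` is horizontal and homogeneous, `λ = r β · dw` with `β` of degree zero, and averaging makes
`β` equivariant. Let `U = (β / 2, 1)` and `W = (w, β · w / 2)`, with `G` acting trivially on the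
additional coordinate. Then `U · dW - W · dU = β · dw`, so `z = √r (U + i W)` satisfies
`Im z̄ · dz = r (U · dW - W · dU) = λ`, the terms in `d√r` cancelling, and `z` is an embedding
because it determines `√r` (from the coordinate `1` of `U`) and `√r w`.
-/

section AveragedRankOne

open MeasureTheory InnerProductSpace Module.End

variable {G : Type*} [Group G]
  {H : Type*} [NormedAddCommGroup H] [InnerProductSpace ℝ H]

/-- The average over the group of the rank one operators `|τ g D⟩⟨τ g D|`. It is compact, symmetric
and equivariant, so that its eigenspaces produce finite-dimensional invariant subspaces. -/
noncomputable def averagedRankOne [MeasurableSpace G] (μ : Measure G) (τ : G →* (H ≃ₗᵢ[ℝ] H))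
    (D : H) : H →L[ℝ] H :=
  ∫ g, rankOne ℝ (τ g D) (τ g D) ∂μ

theorem continuous_rankOne_orbit [TopologicalSpace G] {τ : G →* (H ≃ₗᵢ[ℝ] H)}
    (hτ : ∀ u, Continuous fun g => τ g u) (D : H) :
    Continuous fun g => rankOne ℝ (τ g D) (τ g D) :=
  ((rankOne ℝ (E := H) (F := H)).continuous.comp (hτ D)).clm_apply (hτ D)

theorem isCompactOperator_rankOne (u v : H) :
    IsCompactOperator (rankOne ℝ u v : H →L[ℝ] H) := by
  have : (rankOne ℝ u v : H →L[ℝ] H)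
      = (ContinuousLinearMap.toSpanSingleton ℝ u).comp (innerSL ℝ v) := by
    ext w
    simp [rankOne_apply]
  rw [this]
  exact (isCompactOperator_of_locallyCompactSpace_rng
    (ContinuousLinearMap.toSpanSingleton ℝ u)).comp_clm _

variable [TopologicalSpace G] [CompactSpace G] [MeasurableSpace G] [BorelSpace G]
  (μ : Measure G) [IsProbabilityMeasure μ] {τ : G →* (H ≃ₗᵢ[ℝ] H)}
  (hτ : ∀ u, Continuous fun g => τ g u) (D : H)

include hτ

theorem integrable_rankOne_orbit : Integrable (fun g => rankOne ℝ (τ g D) (τ g D)) μ :=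
  (continuous_rankOne_orbit hτ D).integrable_of_hasCompactSupport (.of_compactSpace _)

theorem integrable_inner_smul_orbit (u : H) :
    Integrable (fun g => inner ℝ (τ g D) u • τ g D) μ :=
  (((hτ D).inner continuous_const).smul (hτ D)).integrable_of_hasCompactSupport
    (.of_compactSpace _)

theorem averagedRankOne_apply [CompleteSpace H] (u : H) :
    averagedRankOne μ τ D u = ∫ g, inner ℝ (τ g D) u • τ g D ∂μ := by
  rw [averagedRankOne, ContinuousLinearMap.integral_apply (integrable_rankOne_orbit μ hτ D)]
  simp only [rankOne_apply]

variable [CompleteSpace H]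

theorem inner_averagedRankOne (u v : H) :
    inner ℝ v (averagedRankOne μ τ D u) = ∫ g, inner ℝ (τ g D) u * inner ℝ (τ g D) v ∂μ := by
  rw [averagedRankOne_apply μ hτ, ← integral_inner (integrable_inner_smul_orbit μ hτ D u)]
  simp only [inner_smul_right, real_inner_comm]

theorem isSymmetric_averagedRankOne : (averagedRankOne μ τ D).IsSymmetric := fun u v => by
  change inner ℝ (averagedRankOne μ τ D u) v = inner ℝ u (averagedRankOne μ τ D v)
  rw [real_inner_comm, inner_averagedRankOne μ hτ, inner_averagedRankOne μ hτ]
  simp only [mul_comm]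

theorem isCompactOperator_averagedRankOne : IsCompactOperator (averagedRankOne μ τ D) :=
  (compactOperator (RingHom.id ℝ) H H).convex.integral_mem isClosed_setOfPred_isCompactOperator
    (.of_forall fun _ => isCompactOperator_rankOne _ _) (integrable_rankOne_orbit μ hτ D)

theorem averagedRankOne_equivariant [IsTopologicalGroup G] [μ.IsMulLeftInvariant] (h : G) (u : H) :
    averagedRankOne μ τ D (τ h u) = τ h (averagedRankOne μ τ D u) := by
  rw [averagedRankOne_apply μ hτ, averagedRankOne_apply μ hτ, ← integral_mul_left_eq_self _ h]
  change _ = (τ h).toContinuousLinearEquiv.toContinuousLinearMap _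
  rw [← ContinuousLinearMap.integral_comp_comm _ (integrable_inner_smul_orbit μ hτ D u)]
  simp

theorem averagedRankOne_self_ne_zero [μ.IsOpenPosMeasure] (hD : D ≠ 0) :
    averagedRankOne μ τ D D ≠ 0 := by
  intro h
  have hint : ∫ g, inner ℝ (τ g D) D * inner ℝ (τ g D) D ∂μ = 0 := by
    rw [← inner_averagedRankOne μ hτ, h, inner_zero_right]
  have hcont : Continuous fun g => inner ℝ (τ g D) D * inner ℝ (τ g D) D :=
    ((hτ D).inner continuous_const).mul ((hτ D).inner continuous_const)
  exact (hcont.integral_pos_of_hasCompactSupport_nonneg_nonzero (μ := μ) (x := 1)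
    (.of_compactSpace _) (fun g => mul_self_nonneg _) (by simpa using hD)).ne' hint

theorem map_mem_eigenspace_averagedRankOne [IsTopologicalGroup G] [μ.IsMulLeftInvariant] {a : ℝ}
    {u : H} (hu : u ∈ eigenspace (averagedRankOne μ τ D : Module.End ℝ H) a) (g : G) :
    τ g u ∈ eigenspace (averagedRankOne μ τ D : Module.End ℝ H) a := by
  rw [mem_eigenspace_iff, ContinuousLinearMap.coe_coe] at hu ⊢
  rw [averagedRankOne_equivariant μ hτ, hu, map_smul]

/-- By the spectral theorem some eigenvector with nonzero eigenvalue pairs nontrivially with `D`,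
because `averagedRankOne μ τ D D ≠ 0`. -/
theorem exists_finiteDimensional_invariant_inner_ne_zero [IsTopologicalGroup G]
    [μ.IsMulLeftInvariant] [μ.IsOpenPosMeasure] (hD : D ≠ 0) :
    ∃ V : Submodule ℝ H, FiniteDimensional ℝ V ∧ (∀ g, ∀ u ∈ V, τ g u ∈ V) ∧
      ∃ e ∈ V, inner ℝ e D ≠ 0 := by
  by_contra! hcon
  set T := averagedRankOne μ τ D
  have hcompact : IsCompactOperator T := isCompactOperator_averagedRankOne μ hτ D
  have hsymm : T.IsSymmetric := isSymmetric_averagedRankOne μ hτ D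
  refine averagedRankOne_self_ne_zero μ hτ D hD ?_
  suffices h : T D ∈ (⨆ a, eigenspace (T : Module.End ℝ H) a)ᗮ by
    rw [ContinuousLinearMap.orthogonalComplement_iSup_eigenspaces_eq_bot hcompact hsymm] at h
    simpa only [Submodule.mem_bot] using h
  rw [← Submodule.iInf_orthogonal, Submodule.mem_iInf]
  refine fun a => (Submodule.mem_orthogonal _ _).2 fun e he => ?_
  have hTe : T e = a • e := mem_eigenspace_iff.1 he
  have hinner : inner ℝ e (T D) = a * inner ℝ e D := by
    rw [← real_inner_smul_left, ← hTe]
    exact (hsymm e D).symm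
  rcases eq_or_ne a 0 with rfl | ha
  · rw [hinner, zero_mul]
  · rw [hinner, hcon _ (ContinuousLinearMap.finite_dimensional_eigenspace hcompact a ha)
      (fun g u hu => map_mem_eigenspace_averagedRankOne μ hτ D hu g) e he, mul_zero]

end AveragedRankOne

section ParametricIntegral

open MeasureTheory

theorem eventually_forall_dist_le_of_continuousOn {G : Type*} [TopologicalSpace G] [CompactSpace G]
    {E F : Type*} [TopologicalSpace E] [PseudoMetricSpace F] {s : Set E} {x₀ : E} (hx₀ : x₀ ∈ s)
    {f : G → E → F} (hf : ContinuousOn (Function.uncurry f) (univ ×ˢ s)) {ε : ℝ} (hε : 0 < ε) :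
    ∀ᶠ x in 𝓝[s] x₀, ∀ g, dist (f g x) (f g x₀) ≤ ε := by
  have key : ∀ᶠ x in 𝓝 x₀, ∀ g ∈ (univ : Set G), x ∈ s → dist (f g x) (f g x₀) ≤ ε := by
    refine isCompact_univ.eventually_forall_of_forall_eventually fun g₀ _ => ?_
    have hnear : ∀ᶠ p : G × E in 𝓝[univ ×ˢ s] (g₀, x₀), dist (f p.1 p.2) (f g₀ x₀) < ε / 2 :=
      (hf _ ⟨mem_univ _, hx₀⟩).eventually (Metric.ball_mem_nhds _ (half_pos hε))
    rw [eventually_nhdsWithin_iff] at hnear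
    filter_upwards [(continuous_swap.tendsto (x₀, g₀)).eventually hnear,
      ((continuous_snd.prodMk continuous_const).tendsto (x₀, g₀)).eventually hnear]
      with z hz hz₀ hzs
    have := dist_triangle_right (f z.2 z.1) (f z.2 x₀) (f g₀ x₀)
    have := hz ⟨mem_univ _, hzs⟩
    have := hz₀ ⟨mem_univ _, hx₀⟩
    simp only [Prod.swap] at *
    linarith
  rw [eventually_nhdsWithin_iff]
  filter_upwards [key] with x hx hxs g using hx g (mem_univ g) hxs

/-- Convex sets are a basis of the neighbourhoods within `s` of each point of `s`. The targets of
the charts of a manifold with boundary have this property, which is what the mean value inequality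
needs. -/
def IsLocallyConvexSet {E : Type*} [AddCommGroup E] [Module ℝ E] [TopologicalSpace E]
    (s : Set E) : Prop :=
  ∀ x ∈ s, ∀ u ∈ 𝓝[s] x, ∃ t ∈ 𝓝[s] x, t ⊆ u ∧ t ⊆ s ∧ Convex ℝ t

theorem isLocallyConvexSet_extChartAt_target {E : Type*} [NormedAddCommGroup E] [NormedSpace ℝ E]
    {H : Type*} [TopologicalSpace H] (I : ModelWithCorners ℝ E H) {M : Type*} [TopologicalSpace M]
    [ChartedSpace H M] (x : M) : IsLocallyConvexSet (extChartAt I x).target := by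
  intro y hy u hu
  have hmem := Filter.inter_mem hu self_mem_nhdsWithin
  rw [nhdsWithin_extChartAt_target_eq_of_mem hy] at hmem ⊢
  obtain ⟨ε, hε, hsub⟩ := Metric.mem_nhdsWithin_iff.1 hmem
  exact ⟨Metric.ball y ε ∩ range I,
    Filter.inter_mem (mem_nhdsWithin_of_mem_nhds (Metric.ball_mem_nhds y hε)) self_mem_nhdsWithin,
    fun z hz => (hsub hz).1, fun z hz => (hsub hz).2, (convex_ball y ε).inter I.convex_range⟩

theorem norm_integral_smul_le {G : Type*} [MeasurableSpace G] {μ : Measure G}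
    {F : Type*} [NormedAddCommGroup F] [NormedSpace ℝ F] {c : G → ℝ} (hc : Integrable c μ)
    {f : G → F} {δ : ℝ} (hf : ∀ g, ‖f g‖ ≤ δ) :
    ‖∫ g, c g • f g ∂μ‖ ≤ (∫ g, ‖c g‖ ∂μ) * δ := by
  rw [← integral_mul_const]
  refine norm_integral_le_of_norm_le (hc.norm.mul_const δ) (.of_forall fun g => ?_)
  rw [norm_smul]
  gcongr
  exact hf g

variable {G : Type*} [TopologicalSpace G] [CompactSpace G]
  {E : Type*} [NormedAddCommGroup E] [NormedSpace ℝ E]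
  {F : Type*} [NormedAddCommGroup F] [NormedSpace ℝ F]

theorem integrable_smul_of_continuous [SecondCountableTopology G] [MeasurableSpace G]
    [BorelSpace G] {μ : Measure G} {c : G → ℝ} (hc : Integrable c μ) {f : G → F}
    (hf : Continuous f) : Integrable (fun g => c g • f g) μ := by
  obtain ⟨C, hC⟩ := isCompact_range hf |>.isBounded.exists_norm_le
  exact hc.smul_bdd C hf.aestronglyMeasurable (.of_forall fun g => hC _ (mem_range_self g))

variable [SecondCountableTopology G] [MeasurableSpace G] [BorelSpace G] {μ : Measure G}

theorem integral_smul_sub_sub_apply [CompleteSpace F] {c : G → ℝ} (hc : Integrable c μ)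
    {f₁ f₀ : G → F} {L : G → E →L[ℝ] F} (hf₁ : Continuous f₁) (hf₀ : Continuous f₀)
    (hL : Continuous L) (v : E) :
    ∫ g, c g • f₁ g ∂μ - ∫ g, c g • f₀ g ∂μ - (∫ g, c g • L g ∂μ) v
      = ∫ g, c g • (f₁ g - f₀ g - L g v) ∂μ := by
  have h₁ := integrable_smul_of_continuous hc hf₁
  have h₀ := integrable_smul_of_continuous hc hf₀
  have h₁₀ : Integrable (fun g => c g • f₁ g - c g • f₀ g) μ := h₁.sub h₀
  have hLv := integrable_smul_of_continuous hc (hL.clm_apply (continuous_const (y := v)))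
  rw [ContinuousLinearMap.integral_apply (integrable_smul_of_continuous hc hL)]
  simp only [smul_apply, smul_sub]
  rw [integral_sub h₁₀ hLv, integral_sub h₁ h₀]

theorem hasFDerivWithinAt_integral_smul [CompleteSpace F] {c : G → ℝ} (hc : Integrable c μ)
    {s : Set E} (hs : IsLocallyConvexSet s) {f : G → E → F} {f' : G → E → E →L[ℝ] F}
    (hf : ∀ x ∈ s, Continuous fun g => f g x)
    (hf' : ContinuousOn (Function.uncurry f') (univ ×ˢ s))
    (hff' : ∀ g, ∀ x ∈ s, HasFDerivWithinAt (f g) (f' g x) s x) {x₀ : E} (hx₀ : x₀ ∈ s) :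
    HasFDerivWithinAt (fun x => ∫ g, c g • f g x ∂μ) (∫ g, c g • f' g x₀ ∂μ) s x₀ := by
  have hf'x₀ : Continuous fun g => f' g x₀ :=
    hf'.comp_continuous (continuous_id.prodMk continuous_const) fun g => ⟨mem_univ _, hx₀⟩
  rw [hasFDerivWithinAt_iff_isLittleO, Asymptotics.isLittleO_iff]
  intro ε hε
  set M := ∫ g, ‖c g‖ ∂μ
  have : 0 ≤ M := integral_nonneg fun _ => norm_nonneg _
  have hδ : 0 < ε / (M + 1) := by positivity
  obtain ⟨t, ht, htu, hts, htconv⟩ :=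
    hs x₀ hx₀ _ (eventually_forall_dist_le_of_continuousOn hx₀ hf' hδ)
  have hx₀t : x₀ ∈ t := mem_of_mem_nhdsWithin hx₀ ht
  filter_upwards [ht] with x hx
  rw [integral_smul_sub_sub_apply hc (hf x (hts hx)) (hf x₀ hx₀) hf'x₀]
  have hmvt : ∀ g, ‖f g x - f g x₀ - f' g x₀ (x - x₀)‖ ≤ ε / (M + 1) * ‖x - x₀‖ := fun g =>
    htconv.norm_image_sub_le_of_norm_hasFDerivWithin_le'
      (fun y hy => (hff' g y (hts hy)).mono hts)
      (fun y hy => by simpa only [dist_eq_norm] using htu hy g) hx₀t hx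
  calc ‖∫ g, c g • (f g x - f g x₀ - f' g x₀ (x - x₀)) ∂μ‖
      ≤ M * (ε / (M + 1) * ‖x - x₀‖) := norm_integral_smul_le hc hmvt
    _ = M / (M + 1) * (ε * ‖x - x₀‖) := by ring
    _ ≤ 1 * (ε * ‖x - x₀‖) := by
        gcongr
        exact (div_le_one (by positivity)).2 (by linarith)
    _ = ε * ‖x - x₀‖ := one_mul _

end ParametricIntegral

section ParametricIntegralSmooth

open MeasureTheory

variable {G : Type*} [TopologicalSpace G]
  {EG : Type*} [NormedAddCommGroup EG] [NormedSpace ℝ EG] [ChartedSpace EG G]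
  {E : Type*} [NormedAddCommGroup E] [NormedSpace ℝ E]
  {F : Type*} [NormedAddCommGroup F] [NormedSpace ℝ F]

theorem contMDiffOn_uncurry_fderivWithin [IsManifold 𝓘(ℝ, EG) ∞ G] {s : Set E}
    (hsu : UniqueDiffOn ℝ s) {f : G → E → F}
    (hf : ContMDiffOn (𝓘(ℝ, EG).prod 𝓘(ℝ, E)) 𝓘(ℝ, F) ∞ (Function.uncurry f) (univ ×ˢ s)) :
    ContMDiffOn (𝓘(ℝ, EG).prod 𝓘(ℝ, E)) 𝓘(ℝ, E →L[ℝ] F) ∞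
      (Function.uncurry fun g x => fderivWithin ℝ (f g) s x) (univ ×ˢ s) := by
  have : IsManifold 𝓘(ℝ, EG) 1 G := IsManifold.of_le (n := ∞) (by simp)
  rintro ⟨g₀, x₀⟩ ⟨-, hx₀⟩
  have hproj : ContMDiff ((𝓘(ℝ, EG).prod 𝓘(ℝ, E)).prod 𝓘(ℝ, E)) (𝓘(ℝ, EG).prod 𝓘(ℝ, E)) ∞
      (fun p : (G × E) × E => (p.1.1, p.2)) :=
    (contMDiff_fst.comp contMDiff_fst).prodMk contMDiff_snd
  have hcurry : ContMDiffWithinAt ((𝓘(ℝ, EG).prod 𝓘(ℝ, E)).prod 𝓘(ℝ, E)) 𝓘(ℝ, F) ∞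
      (Function.uncurry fun (p : G × E) (x : E) => f p.1 x) ((univ ×ˢ s) ×ˢ s) ((g₀, x₀), x₀) :=
    ContMDiffWithinAt.comp (t := univ ×ˢ s) (f := fun p : (G × E) × E => (p.1.1, p.2))
      ((g₀, x₀), x₀) (hf (g₀, x₀) ⟨mem_univ _, hx₀⟩) (hproj _).contMDiffWithinAt
      (fun p hp => ⟨mem_univ _, hp.2⟩)
  have h := hcurry.mfderivWithin contMDiffWithinAt_snd (x₀ := (g₀, x₀)) (g := Prod.snd)
    ⟨mem_univ _, hx₀⟩ (fun p hp => hp.2) (m := ∞) (by simp) hsu.uniqueMDiffOn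
  simp only [inTangentCoordinates_model_space, mfderivWithin_eq_fderivWithin] at h
  exact h

theorem differentiableOn_of_contMDiffOn_uncurry {s : Set E} {f : G → E → F}
    (hf : ContMDiffOn (𝓘(ℝ, EG).prod 𝓘(ℝ, E)) 𝓘(ℝ, F) ∞ (Function.uncurry f) (univ ×ˢ s))
    (g : G) : DifferentiableOn ℝ (f g) s := by
  have hslice : ContMDiff 𝓘(ℝ, E) (𝓘(ℝ, EG).prod 𝓘(ℝ, E)) ∞ fun x : E => (g, x) :=
    contMDiff_const.prodMk contMDiff_id
  have h : ContMDiffOn 𝓘(ℝ, E) 𝓘(ℝ, F) ∞ (f g) s :=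
    hf.comp hslice.contMDiffOn fun x hx => ⟨mem_univ _, hx⟩
  exact h.contDiffOn.differentiableOn (by simp)

variable [CompactSpace G] [SecondCountableTopology G] [MeasurableSpace G] [BorelSpace G]
  [IsManifold 𝓘(ℝ, EG) ∞ G] {μ : Measure G} {c : G → ℝ} [CompleteSpace F]

theorem hasFDerivWithinAt_integral_of_contMDiffOn (hc : Integrable c μ)
    {s : Set E} (hs : IsLocallyConvexSet s) (hsu : UniqueDiffOn ℝ s) {f : G → E → F}
    (hf : ContMDiffOn (𝓘(ℝ, EG).prod 𝓘(ℝ, E)) 𝓘(ℝ, F) ∞ (Function.uncurry f) (univ ×ˢ s))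
    {x₀ : E} (hx₀ : x₀ ∈ s) :
    HasFDerivWithinAt (fun x => ∫ g, c g • f g x ∂μ)
      (∫ g, c g • fderivWithin ℝ (f g) s x₀ ∂μ) s x₀ :=
  hasFDerivWithinAt_integral_smul hc hs (f' := fun g x => fderivWithin ℝ (f g) s x)
    (fun _ hx => hf.continuousOn.comp_continuous (continuous_id.prodMk continuous_const)
      fun _ => ⟨mem_univ _, hx⟩)
    (contMDiffOn_uncurry_fderivWithin hsu hf).continuousOn
    (fun g x hx => (differentiableOn_of_contMDiffOn_uncurry hf g x hx).hasFDerivWithinAt) hx₀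

theorem contDiffOn_integral_smul [FiniteDimensional ℝ E] (hc : Integrable c μ)
    {s : Set E} (hs : IsLocallyConvexSet s) (hsu : UniqueDiffOn ℝ s) (n : ℕ) {f : G → E → F}
    (hf : ContMDiffOn (𝓘(ℝ, EG).prod 𝓘(ℝ, E)) 𝓘(ℝ, F) ∞ (Function.uncurry f) (univ ×ˢ s)) :
    ContDiffOn ℝ n (fun x => ∫ g, c g • f g x ∂μ) s := by
  have hderiv := fun {f : G → E → F} hf {x₀ : E} hx₀ =>
    hasFDerivWithinAt_integral_of_contMDiffOn (EG := EG) (f := f) hc hs hsu hf (x₀ := x₀) hx₀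
  induction n generalizing f with
  | zero => exact contDiffOn_zero.2 fun x hx => (hderiv hf hx).continuousWithinAt
  | succ n ih =>
    have hf' := contMDiffOn_uncurry_fderivWithin hsu hf
    have hint : ∀ x ∈ s, Integrable (fun g => c g • fderivWithin ℝ (f g) s x) μ := fun x hx =>
      integrable_smul_of_continuous hc (hf'.continuousOn.comp_continuous
        (continuous_id.prodMk continuous_const) fun g => ⟨mem_univ _, hx⟩)
    rw [Nat.cast_succ, contDiffOn_succ_iff_fderivWithin hsu]
    refine ⟨fun x hx => (hderiv hf hx).differentiableWithinAt, by simp,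
      contDiffOn_clm_apply.2 fun y => ?_⟩
    refine (ih (f := fun g x => fderivWithin ℝ (f g) s x y)
      (hf'.clm_apply contMDiffOn_const)).congr fun x hx => ?_
    rw [(hderiv hf hx).fderivWithin (hsu x hx), ContinuousLinearMap.integral_apply (hint x hx)]
    simp only [smul_apply]

end ParametricIntegralSmooth

/-- The differential of a vector-valued map on a manifold, as a continuous linear map on the model
space. It is the manifold derivative, except that the latter is defined on `TangentSpace IS x`,
which carries no norm. -/
noncomputable def differential {ES : Type*} [NormedAddCommGroup ES] [NormedSpace ℝ ES]
    {HS : Type*} [TopologicalSpace HS] (IS : ModelWithCorners ℝ ES HS)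
    {S : Type*} [TopologicalSpace S] [ChartedSpace HS S]
    {F : Type*} [NormedAddCommGroup F] [NormedSpace ℝ F] (f : S → F) (x : S) : ES →L[ℝ] F :=
  mfderiv IS 𝓘(ℝ, F) f x

section ParametricIntegralManifold

open MeasureTheory

variable {G : Type*} [TopologicalSpace G]
  {EG : Type*} [NormedAddCommGroup EG] [NormedSpace ℝ EG] [ChartedSpace EG G]
  {F : Type*} [NormedAddCommGroup F] [NormedSpace ℝ F]
  {ES : Type*} [NormedAddCommGroup ES] [NormedSpace ℝ ES]
  {HS : Type*} [TopologicalSpace HS] {IS : ModelWithCorners ℝ ES HS}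
  {S : Type*} [TopologicalSpace S] [ChartedSpace HS S]

theorem differential_eq_fderivWithin {h : S → F} {x : S} (hh : MDifferentiableAt IS 𝓘(ℝ, F) h x) :
    differential IS h x = fderivWithin ℝ (fun y => h ((extChartAt IS x).symm y))
      (extChartAt IS x).target (extChartAt IS x x) := by
  have h' : HasFDerivWithinAt (fun y => h ((extChartAt IS x).symm y)) (differential IS h x)
      (range IS) (extChartAt IS x x) := hh.hasMFDerivAt.2
  exact ((h'.mono (extChartAt_target_subset_range x)).fderivWithin
    (uniqueDiffOn_extChartAt_target x _ (mem_extChartAt_target x))).symm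

theorem mdifferentiableAt_of_contMDiff_uncurry {f : G → S → F}
    (hf : ContMDiff (𝓘(ℝ, EG).prod IS) 𝓘(ℝ, F) ∞ (Function.uncurry f)) (g : G) (x : S) :
    MDifferentiableAt IS 𝓘(ℝ, F) (f g) x :=
  ((hf.comp (contMDiff_const.prodMk contMDiff_id : ContMDiff IS (𝓘(ℝ, EG).prod IS) ∞
    fun x : S => (g, x))).mdifferentiable (by simp)) x

variable [IsManifold IS ∞ S] {f : G → S → F}
  (hf : ContMDiff (𝓘(ℝ, EG).prod IS) 𝓘(ℝ, F) ∞ (Function.uncurry f))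

include hf

theorem contMDiffOn_uncurry_extChartAt_symm (x : S) :
    ContMDiffOn (𝓘(ℝ, EG).prod 𝓘(ℝ, ES)) 𝓘(ℝ, F) ∞
      (Function.uncurry fun g y => f g ((extChartAt IS x).symm y))
      (univ ×ˢ (extChartAt IS x).target) :=
  hf.comp_contMDiffOn <|
    contMDiffOn_fst.prodMk ((contMDiffOn_extChartAt_symm x).comp contMDiffOn_snd fun _ hp => hp.2)

variable [IsManifold 𝓘(ℝ, EG) ∞ G]

theorem continuous_differential_of_contMDiff_uncurry (x : S) :
    Continuous fun g => differential IS (f g) x := by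
  have hcont := (contMDiffOn_uncurry_fderivWithin (uniqueDiffOn_extChartAt_target x)
    (contMDiffOn_uncurry_extChartAt_symm hf x)).continuousOn.comp_continuous
    (f := fun g : G => (g, extChartAt IS x x)) (continuous_id.prodMk continuous_const)
    fun g => ⟨mem_univ _, mem_extChartAt_target x⟩
  refine hcont.congr fun g => ?_
  rw [differential_eq_fderivWithin (mdifferentiableAt_of_contMDiff_uncurry hf g x)]
  rfl

variable [CompactSpace G] [SecondCountableTopology G] [MeasurableSpace G] [BorelSpace G]
  {μ : Measure G} {c : G → ℝ} [CompleteSpace F]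
  [FiniteDimensional ℝ ES]

theorem contMDiff_integral_smul (hc : Integrable c μ) :
    ContMDiff IS 𝓘(ℝ, F) ∞ fun x => ∫ g, c g • f g x ∂μ := by
  intro x
  have hchart : ContDiffOn ℝ ∞ (fun y => ∫ g, c g • f g ((extChartAt IS x).symm y) ∂μ)
      (extChartAt IS x).target :=
    contDiffOn_infty.2 fun n => contDiffOn_integral_smul hc
      (isLocallyConvexSet_extChartAt_target IS x) (uniqueDiffOn_extChartAt_target x) n
      (contMDiffOn_uncurry_extChartAt_symm hf x)
  have hcomp : ContMDiffOn IS 𝓘(ℝ, F) ∞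
      ((fun y => ∫ g, c g • f g ((extChartAt IS x).symm y) ∂μ) ∘ extChartAt IS x)
      (chartAt HS x).source :=
    hchart.contMDiffOn.comp contMDiffOn_extChartAt
      fun y hy => (extChartAt IS x).map_source (by rwa [extChartAt_source])
  have hmem : (chartAt HS x).source ∈ 𝓝 x := chart_source_mem_nhds HS x
  refine (hcomp.contMDiffAt hmem).congr_of_eventuallyEq ?_
  filter_upwards [hmem] with y hy
  rw [← extChartAt_source IS] at hy
  simp only [Function.comp_apply, (extChartAt IS x).left_inv hy]

theorem differential_integral_smul (hc : Integrable c μ) (x : S) :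
    differential IS (fun x => ∫ g, c g • f g x ∂μ) x = ∫ g, c g • differential IS (f g) x ∂μ := by
  have hderiv := hasFDerivWithinAt_integral_of_contMDiffOn hc
    (isLocallyConvexSet_extChartAt_target IS x) (uniqueDiffOn_extChartAt_target x)
    (contMDiffOn_uncurry_extChartAt_symm hf x) (mem_extChartAt_target x)
  rw [differential_eq_fderivWithin ((contMDiff_integral_smul hf hc).mdifferentiable (by simp) x),
    hderiv.fderivWithin (uniqueDiffOn_extChartAt_target x _ (mem_extChartAt_target x))]
  simp only [differential_eq_fderivWithin (mdifferentiableAt_of_contMDiff_uncurry hf _ x)]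

theorem differential_integral_smul_apply (hc : Integrable c μ) (x : S) (v : ES) :
    differential IS (fun x => ∫ g, c g • f g x ∂μ) x v
      = ∫ g, c g • differential IS (f g) x v ∂μ := by
  rw [differential_integral_smul hf hc]
  exact ContinuousLinearMap.integral_apply (integrable_smul_of_continuous hc
    (continuous_differential_of_contMDiff_uncurry hf x)) v

end ParametricIntegralManifold

section Differential

variable {ES : Type*} [NormedAddCommGroup ES] [NormedSpace ℝ ES]
  {HS : Type*} [TopologicalSpace HS] {IS : ModelWithCorners ℝ ES HS}
  {S : Type*} [TopologicalSpace S] [ChartedSpace HS S]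
  {F : Type*} [NormedAddCommGroup F] [NormedSpace ℝ F]
  {F' : Type*} [NormedAddCommGroup F'] [NormedSpace ℝ F']
  {F'' : Type*} [NormedAddCommGroup F''] [NormedSpace ℝ F'']

theorem differential_const (c : F) (x : S) : differential IS (fun _ : S => c) x = 0 :=
  mfderiv_const

theorem differential_comp_of_hasFDerivAt {f : S → F} {x : S}
    (hf : MDifferentiableAt IS 𝓘(ℝ, F) f x) {φ : F → F'} {φ' : F →L[ℝ] F'}
    (hφ : HasFDerivAt φ φ' (f x)) (v : ES) :
    differential IS (fun y => φ (f y)) x v = φ' (differential IS f x v) := by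
  have h : mfderiv IS 𝓘(ℝ, F') (φ ∘ f) x = _ := (hφ.hasMFDerivAt.comp x hf.hasMFDerivAt).mfderiv
  exact congrArg (fun L : ES →L[ℝ] F' => L v) h

theorem differential_clm_comp {f : S → F} {x : S} (hf : MDifferentiableAt IS 𝓘(ℝ, F) f x)
    (L : F →L[ℝ] F') (v : ES) :
    differential IS (fun y => L (f y)) x v = L (differential IS f x v) :=
  differential_comp_of_hasFDerivAt hf L.hasFDerivAt v

theorem injective_differential_of_clm_comp {f : S → F} {x : S}
    (hf : MDifferentiableAt IS 𝓘(ℝ, F) f x) (L : F →L[ℝ] F')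
    (hL : Function.Injective (differential IS (fun y => L (f y)) x)) :
    Function.Injective (differential IS f x) := fun v v' hv =>
  hL <| (differential_clm_comp hf L v).trans
    ((congrArg L hv).trans (differential_clm_comp hf L v').symm)

theorem differential_pi_apply {ι : Type*} [Fintype ι] {f : S → ι → F} {x : S}
    (hf : MDifferentiableAt IS 𝓘(ℝ, ι → F) f x) (v : ES) (i : ι) :
    differential IS f x v i = differential IS (fun y => f y i) x v :=
  (differential_clm_comp hf (ContinuousLinearMap.proj (φ := fun _ : ι => F) i) v).symm

theorem differential_prodMk {f : S → F} {f' : S → F'} {x : S}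
    (hf : MDifferentiableAt IS 𝓘(ℝ, F) f x) (hf' : MDifferentiableAt IS 𝓘(ℝ, F') f' x) (v : ES) :
    differential IS (fun y => (f y, f' y)) x v = (differential IS f x v, differential IS f' x v) :=
  have h := hf.prodMk_space hf'
  Prod.ext (differential_clm_comp h (ContinuousLinearMap.fst ℝ F F') v).symm
    (differential_clm_comp h (ContinuousLinearMap.snd ℝ F F') v).symm

theorem differential_bilinear {f : S → F} {g : S → F'} {x : S}
    (hf : MDifferentiableAt IS 𝓘(ℝ, F) f x) (hg : MDifferentiableAt IS 𝓘(ℝ, F') g x)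
    (B : F →L[ℝ] F' →L[ℝ] F'') (v : ES) :
    differential IS (fun y => B (f y) (g y)) x v
      = B (f x) (differential IS g x v) + B (differential IS f x v) (g x) := by
  have hB : HasFDerivAt (fun p : F × F' => B p.1 p.2) _ (f x, g x) :=
    B.hasFDerivAt_of_bilinear hasFDerivAt_fst hasFDerivAt_snd
  refine (differential_comp_of_hasFDerivAt (hf.prodMk_space hg) hB v).trans ?_
  rw [differential_prodMk hf hg]
  rfl

theorem differential_smul {f : S → ℝ} {g : S → F} {x : S} (hf : MDifferentiableAt IS 𝓘(ℝ, ℝ) f x)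
    (hg : MDifferentiableAt IS 𝓘(ℝ, F) g x) (v : ES) :
    differential IS (fun y => f y • g y) x v
      = f x • differential IS g x v + differential IS f x v • g x :=
  differential_bilinear hf hg (.lsmul ℝ ℝ) v

theorem differential_comp_self_map {f : S → F} {φ : S → S} {x : S}
    (hf : MDifferentiableAt IS 𝓘(ℝ, F) f (φ x)) (hφ : MDifferentiableAt IS IS φ x) (v : ES) :
    differential IS (fun y => f (φ y)) x v = differential IS f (φ x) (mfderiv IS IS φ x v) := by
  have h : mfderiv IS 𝓘(ℝ, F) (f ∘ φ) x = _ := mfderiv_comp x hf hφ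
  exact congrArg (fun L : ES →L[ℝ] F => L v) h

theorem contMDiffOn_clm_of_apply [FiniteDimensional ℝ F] {A : S → F →L[ℝ] F'} {U : Set S}
    (hA : ∀ u, ContMDiffOn IS 𝓘(ℝ, F') ∞ (fun x => A x u) U) :
    ContMDiffOn IS 𝓘(ℝ, F →L[ℝ] F') ∞ A U := by
  let b := Module.finBasis ℝ F
  have hsum : A = fun x => ∑ i, ContinuousLinearMap.smulRightL ℝ F F'
      (LinearMap.toContinuousLinearMap (b.coord i)) (A x (b i)) := by
    ext x u
    conv_lhs => rw [← b.sum_repr u, map_sum]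
    simp
  rw [hsum]
  exact contMDiffOn_finsetSum fun i _ =>
    ((ContinuousLinearMap.smulRightL ℝ F F' _).contMDiff.comp_contMDiffOn (hA (b i)))

end Differential

section Immersion

section LinearAlgebra

variable {E : Type*} [NormedAddCommGroup E] [NormedSpace ℝ E] [FiniteDimensional ℝ E]
  {F : Type*} [NormedAddCommGroup F] [NormedSpace ℝ F]

theorem exists_contDiffOn_leftInverse [FiniteDimensional ℝ F] {A₀ : E →L[ℝ] F}
    (hA₀ : Function.Injective A₀) :
    ∃ V ∈ 𝓝 A₀, ∃ Λ : (E →L[ℝ] F) → F →L[ℝ] E, ContDiffOn ℝ ∞ Λ V ∧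
      ∀ A ∈ V, ∀ u, Λ A (A u) = u := by
  obtain ⟨L₀, hL₀⟩ := LinearMap.exists_leftInverse_of_injective (A₀ : E →ₗ[ℝ] F)
    (LinearMap.ker_eq_bot.2 hA₀)
  set L : F →L[ℝ] E := LinearMap.toContinuousLinearMap L₀
  have hLA₀ : L.comp A₀ = ContinuousLinearMap.id ℝ E :=
    ContinuousLinearMap.ext (LinearMap.congr_fun hL₀)
  have hL : ContDiff ℝ ∞ fun A : E →L[ℝ] F => L.comp A :=
    (ContinuousLinearMap.compL ℝ E F E L).contDiff
  refine ⟨{A | L.comp A ∈ range ((↑) : (E ≃L[ℝ] E) → E →L[ℝ] E)}, ?_,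
    fun A => (L.comp A).inverse.comp L, fun A hA => ?_, fun A hA u => ?_⟩
  · refine hL.continuous.continuousAt.preimage_mem_nhds ?_
    rw [hLA₀]
    exact (ContinuousLinearEquiv.refl ℝ E).nhds
  · obtain ⟨e, he : (e : E →L[ℝ] E) = L.comp A⟩ := hA
    have hinv : ContDiffAt ℝ ∞ ContinuousLinearMap.inverse (L.comp A) := by
      rw [← he]
      exact contDiffAt_map_inverse e
    exact ((hinv.comp A hL.contDiffAt).clm_comp contDiffAt_const).contDiffWithinAt
  · obtain ⟨e, he : (e : E →L[ℝ] E) = L.comp A⟩ := hA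
    change (L.comp A).inverse ((L.comp A) u) = u
    rw [← he, ContinuousLinearMap.inverse_equiv]
    exact e.symm_apply_apply u

theorem exists_mem_nhdsWithin_injOn_of_injective_hasFDerivWithinAt {s : Set E}
    (hs : IsLocallyConvexSet s) {f : E → F} {f' : E → E →L[ℝ] F}
    (hf : ∀ x ∈ s, HasFDerivWithinAt f (f' x) s x) (hf' : ContinuousOn f' s) {x₀ : E}
    (hx₀ : x₀ ∈ s) (hinj : Function.Injective (f' x₀)) : ∃ t ∈ 𝓝[s] x₀, InjOn f t := by
  obtain ⟨K, hK, hanti⟩ := (f' x₀ : E →ₗ[ℝ] F).injective_iff_antilipschitz.1 hinj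
  have hK' : (0 : ℝ) < K := NNReal.coe_pos.2 hK
  have hclose : ∀ᶠ x in 𝓝[s] x₀, ‖f' x - f' x₀‖ < (2 * K : ℝ)⁻¹ := by
    filter_upwards [(hf' x₀ hx₀).eventually
      (Metric.ball_mem_nhds _ (inv_pos.2 (mul_pos two_pos hK')))] with x hx
    rwa [← dist_eq_norm]
  obtain ⟨t, ht, htclose, hts, htconv⟩ := hs x₀ hx₀ _ hclose
  refine ⟨t, ht, fun x hx y hy hxy => ?_⟩
  have hmvt := htconv.norm_image_sub_le_of_norm_hasFDerivWithin_le'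
    (fun z hz => (hf z (hts hz)).mono hts) (fun z hz => (htclose hz).le) hx hy
  rw [hxy, sub_self, zero_sub, norm_neg] at hmvt
  have hle : ‖y - x‖ ≤ K * ‖f' x₀ (y - x)‖ := by
    simpa only [dist_eq_norm, map_sub, ContinuousLinearMap.coe_coe] using hanti.le_mul_dist y x
  have hhalf : ‖y - x‖ ≤ 1 / 2 * ‖y - x‖ := calc
    ‖y - x‖ ≤ K * ((2 * K : ℝ)⁻¹ * ‖y - x‖) := by
      refine hle.trans ?_
      gcongr
    _ = 1 / 2 * ‖y - x‖ := by
      field_simp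
  exact (sub_eq_zero.1 (norm_le_zero_iff.1 (by linarith))).symm

end LinearAlgebra

variable {ES : Type*} [NormedAddCommGroup ES] [NormedSpace ℝ ES]
  {HS : Type*} [TopologicalSpace HS] {IS : ModelWithCorners ℝ ES HS}
  {S : Type*} [TopologicalSpace S] [ChartedSpace HS S]
  {F : Type*} [NormedAddCommGroup F] [NormedSpace ℝ F]

/-- The differential of `f` at `x`, read in the chart around `x₀`. Unlike `differential IS f x`, it
depends smoothly on `x`. -/
noncomputable def chartDifferential (IS : ModelWithCorners ℝ ES HS) (f : S → F) (x₀ x : S) :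
    ES →L[ℝ] F :=
  fderivWithin ℝ (fun y => f ((extChartAt IS x₀).symm y)) (extChartAt IS x₀).target
    (extChartAt IS x₀ x)

theorem chartDifferential_self {f : S → F} {x : S} (hf : MDifferentiableAt IS 𝓘(ℝ, F) f x) :
    chartDifferential IS f x x = differential IS f x :=
  (differential_eq_fderivWithin hf).symm

variable [IsManifold IS ∞ S]

/-- The frame of the tangent bundle defined by the chart around `x₀`. -/
noncomputable def chartFrame (IS : ModelWithCorners ℝ ES HS) [IsManifold IS ∞ S] (x₀ x : S) :
    ES →L[ℝ] ES :=
  have : IsManifold IS 1 S := IsManifold.of_le (n := ∞) (by simp)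
  (trivializationAt ES (TangentSpace IS) x₀).symmL ℝ x

theorem surjective_chartFrame {x₀ x : S} (hx : x ∈ (chartAt HS x₀).source) :
    Function.Surjective (chartFrame IS x₀ x) := by
  have : IsManifold IS 1 S := IsManifold.of_le (n := ∞) (by simp)
  rw [← TangentBundle.trivializationAt_baseSet (I := IS)] at hx
  exact fun v => ⟨(trivializationAt ES (TangentSpace IS) x₀).continuousLinearMapAt ℝ x v,
    (trivializationAt ES (TangentSpace IS) x₀).symmL_continuousLinearMapAt hx v⟩

theorem contMDiffOn_oneForm_chartFrame (w : SmoothOneForm IS S) (x₀ : S) (u : ES) :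
    ContMDiffOn IS 𝓘(ℝ, ℝ) ∞ (fun x => w x (chartFrame IS x₀ x u)) (chartAt HS x₀).source := by
  have : IsManifold IS 1 S := IsManifold.of_le (n := ∞) (by simp)
  have hframe := (trivializationAt ES (TangentSpace IS : S → Type _) x₀).contMDiffOn_symmL
    (n := ∞) (IB := IS)
  rw [TangentBundle.trivializationAt_baseSet] at hframe
  have hconst : ContMDiffOn IS (IS.prod 𝓘(ℝ, ES)) ∞
      (fun m => Bundle.TotalSpace.mk' ES (E := Bundle.Trivial S ES) m u) (chartAt HS x₀).source :=
    fun x _ => Bundle.contMDiffWithinAt_section.2 contMDiffWithinAt_const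
  have happly := (w.contMDiff.contMDiffOn (s := (chartAt HS x₀).source)).clm_bundle_apply
    (hframe.clm_bundle_apply hconst)
  exact fun x hx => Bundle.contMDiffWithinAt_section.1 (happly x hx)

variable {f : S → F} (hf : ContMDiff IS 𝓘(ℝ, F) ∞ f)

include hf

theorem contDiffOn_comp_extChartAt_symm (x₀ : S) :
    ContDiffOn ℝ ∞ (fun y => f ((extChartAt IS x₀).symm y)) (extChartAt IS x₀).target :=
  (hf.comp_contMDiffOn (contMDiffOn_extChartAt_symm x₀)).contDiffOn

theorem contMDiffOn_chartDifferential (x₀ : S) :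
    ContMDiffOn IS 𝓘(ℝ, ES →L[ℝ] F) ∞ (chartDifferential IS f x₀) (chartAt HS x₀).source :=
  ((contDiffOn_comp_extChartAt_symm hf x₀).fderivWithin (m := ∞)
    (uniqueDiffOn_extChartAt_target x₀) (by simp)).contMDiffOn.comp contMDiffOn_extChartAt
    fun y hy => (extChartAt IS x₀).map_source (by rwa [extChartAt_source])

theorem differential_chartFrame {x₀ x : S} (hx : x ∈ (chartAt HS x₀).source) (u : ES) :
    differential IS f x (chartFrame IS x₀ x u) = chartDifferential IS f x₀ x u := by
  have : IsManifold IS 1 S := IsManifold.of_le (n := ∞) (by simp)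
  have hx' : x ∈ (extChartAt IS x₀).source := by rwa [extChartAt_source]
  have ht := (extChartAt IS x₀).map_source hx'
  have hframe : chartFrame IS x₀ x = mfderivWithin 𝓘(ℝ, ES) IS (extChartAt IS x₀).symm (range IS)
      (extChartAt IS x₀ x) := TangentBundle.symmL_trivializationAt hx
  have hsymm : MDifferentiableWithinAt 𝓘(ℝ, ES) IS (extChartAt IS x₀).symm (range IS)
      (extChartAt IS x₀ x) := mdifferentiableWithinAt_extChartAt_symm ht
  have hfd : MDifferentiableAt IS 𝓘(ℝ, F) f ((extChartAt IS x₀).symm (extChartAt IS x₀ x)) :=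
    hf.mdifferentiable (by simp) _
  have hcomp : HasFDerivWithinAt (fun y => f ((extChartAt IS x₀).symm y))
      ((differential IS f ((extChartAt IS x₀).symm (extChartAt IS x₀ x))).comp
        (chartFrame IS x₀ x)) (range IS) (extChartAt IS x₀ x) := by
    rw [hframe]
    exact (hfd.hasMFDerivAt.comp_hasMFDerivWithinAt _ hsymm.hasMFDerivWithinAt).hasFDerivWithinAt
  have hchart : chartDifferential IS f x₀ x u =
      differential IS f ((extChartAt IS x₀).symm (extChartAt IS x₀ x)) (chartFrame IS x₀ x u) :=
    congrArg (fun L : ES →L[ℝ] F => L u)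
      ((hcomp.mono (extChartAt_target_subset_range x₀)).fderivWithin
        (uniqueDiffOn_extChartAt_target x₀ _ ht))
  rw [hchart, (extChartAt IS x₀).left_inv hx']

variable [FiniteDimensional ℝ ES]

theorem exists_nhds_injOn_of_injective_differential {x₀ : S}
    (hinj : Function.Injective (differential IS f x₀)) : ∃ U ∈ 𝓝 x₀, InjOn f U := by
  have hchart := contDiffOn_comp_extChartAt_symm hf x₀
  obtain ⟨t, ht, htinj⟩ := exists_mem_nhdsWithin_injOn_of_injective_hasFDerivWithinAt
    (isLocallyConvexSet_extChartAt_target IS x₀)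
    (fun y hy => (hchart.differentiableOn (by simp) y hy).hasFDerivWithinAt)
    (hchart.continuousOn_fderivWithin (uniqueDiffOn_extChartAt_target x₀) (by simp))
    (mem_extChartAt_target x₀) (by
      rwa [← differential_eq_fderivWithin (hf.mdifferentiable (by simp) x₀)])
  rw [nhdsWithin_extChartAt_target_eq] at ht
  refine ⟨(extChartAt IS x₀).source ∩ extChartAt IS x₀ ⁻¹' t,
    Filter.inter_mem (extChartAt_source_mem_nhds x₀)
      (extChartAt_preimage_mem_nhds_of_mem_nhdsWithin (mem_extChartAt_source x₀) ht), ?_⟩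
  rintro x ⟨hx, hxt⟩ y ⟨hy, hyt⟩ hxy
  refine (extChartAt IS x₀).injOn hx hy (htinj hxt hyt ?_)
  simp only [(extChartAt IS x₀).left_inv hx, (extChartAt IS x₀).left_inv hy, hxy]

variable [FiniteDimensional ℝ F]

theorem exists_nhds_contMDiffOn_leftInverse_chartDifferential {x₀ : S}
    (hinj : Function.Injective (differential IS f x₀)) :
    ∃ U ∈ 𝓝 x₀, U ⊆ (chartAt HS x₀).source ∧ ∃ Λ : S → F →L[ℝ] ES,
      ContMDiffOn IS 𝓘(ℝ, F →L[ℝ] ES) ∞ Λ U ∧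
      ∀ x ∈ U, ∀ u, Λ x (chartDifferential IS f x₀ x u) = u := by
  rw [← chartDifferential_self (hf.mdifferentiable (by simp) x₀)] at hinj
  obtain ⟨V, hV, Λ, hΛ, hΛinv⟩ := exists_contDiffOn_leftInverse hinj
  have hsource := chart_source_mem_nhds HS x₀
  have hsmooth := contMDiffOn_chartDifferential hf x₀
  refine ⟨(chartAt HS x₀).source ∩ chartDifferential IS f x₀ ⁻¹' V,
    Filter.inter_mem hsource ((hsmooth.continuousOn.continuousAt hsource).preimage_mem_nhds hV),
    inter_subset_left, fun x => Λ (chartDifferential IS f x₀ x), ?_, fun x hx => hΛinv _ hx.2⟩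
  exact hΛ.contMDiffOn.comp (hsmooth.mono inter_subset_left) fun x hx => hx.2

theorem eventually_injective_differential {x₀ : S}
    (hinj : Function.Injective (differential IS f x₀)) :
    ∀ᶠ x in 𝓝 x₀, Function.Injective (differential IS f x) := by
  obtain ⟨U, hU, hUsource, Λ, -, hΛ⟩ :=
    exists_nhds_contMDiffOn_leftInverse_chartDifferential hf hinj
  filter_upwards [hU] with x hx
  rw [injective_iff_map_eq_zero]
  intro v hv
  obtain ⟨u, rfl⟩ := surjective_chartFrame (IS := IS) (hUsource hx) v
  rw [differential_chartFrame hf (hUsource hx)] at hv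
  rw [← hΛ x hx u, hv, map_zero, map_zero]

theorem exists_nhds_oneForm_eq_comp_differential (w : SmoothOneForm IS S) {x₀ : S}
    (hinj : Function.Injective (differential IS f x₀)) :
    ∃ U ∈ 𝓝 x₀, ∃ b : S → F →L[ℝ] ℝ, ContMDiffOn IS 𝓘(ℝ, F →L[ℝ] ℝ) ∞ b U ∧
      ∀ x ∈ U, ∀ v : ES, b x (differential IS f x v) = w x v := by
  obtain ⟨U, hU, hUsource, Λ, hΛ, hΛinv⟩ :=
    exists_nhds_contMDiffOn_leftInverse_chartDifferential hf hinj
  have hw : ContMDiffOn IS 𝓘(ℝ, ES →L[ℝ] ℝ) ∞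
      (fun x => (show ES →L[ℝ] ℝ from w x).comp (chartFrame IS x₀ x)) (chartAt HS x₀).source :=
    contMDiffOn_clm_of_apply (contMDiffOn_oneForm_chartFrame w x₀)
  refine ⟨U, hU, _, (hw.mono hUsource).clm_comp hΛ, fun x hx v => ?_⟩
  obtain ⟨u, rfl⟩ := surjective_chartFrame (IS := IS) (hUsource hx) v
  rw [differential_chartFrame hf (hUsource hx)]
  change w x (chartFrame IS x₀ x (Λ x _)) = _
  rw [hΛinv x hx]

theorem exists_oneForm_eq_comp_differential [T2Space S] [SigmaCompactSpace S]
    (hinj : ∀ x, Function.Injective (differential IS f x)) (w : SmoothOneForm IS S) :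
    ∃ b : S → F →L[ℝ] ℝ, ContMDiff IS 𝓘(ℝ, F →L[ℝ] ℝ) ∞ b ∧
      ∀ x (v : ES), b x (differential IS f x v) = w x v := by
  obtain ⟨b, hb⟩ := exists_contMDiffMap_forall_mem_convex_of_local IS (n := ⊤)
    (t := fun x : S => {L : F →L[ℝ] ℝ | ∀ v : ES, L (differential IS f x v) = w x v})
    (fun x L hL L' hL' a a' _ _ haa' v => by
      rw [add_apply, smul_apply, smul_apply, hL v, hL' v, ← add_smul, haa', one_smul])
    (fun x => exists_nhds_oneForm_eq_comp_differential hf w (hinj x))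
  exact ⟨b, b.contMDiff, hb⟩

end Immersion

theorem pullbackOneForm_comp
    {ES : Type*} [NormedAddCommGroup ES] [NormedSpace ℝ ES] {HS : Type*} [TopologicalSpace HS]
    {IS : ModelWithCorners ℝ ES HS}
    {S : Type*} [TopologicalSpace S] [ChartedSpace HS S] [IsManifold IS ∞ S]
    (w : SmoothOneForm IS S) {f g : S → S} {x : S}
    (hf : MDifferentiableAt IS IS f (g x)) (hg : MDifferentiableAt IS IS g x)
    (v : TangentSpace IS x) :
    pullbackOneForm (f ∘ g) w x v = pullbackOneForm f w (g x) (mfderiv IS IS g x v) := by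
  rw [pullbackOneForm, mfderiv_comp x hf hg]
  rfl

theorem pullbackOneForm_id
    {ES : Type*} [NormedAddCommGroup ES] [NormedSpace ℝ ES] {HS : Type*} [TopologicalSpace HS]
    {IS : ModelWithCorners ℝ ES HS}
    {S : Type*} [TopologicalSpace S] [ChartedSpace HS S] [IsManifold IS ∞ S]
    (w : SmoothOneForm IS S) (x : S) (v : TangentSpace IS x) :
    pullbackOneForm id w x v = w x v := by
  rw [pullbackOneForm, mfderiv_id]
  rfl

namespace SmoothCone

variable
    {ES : Type*} [NormedAddCommGroup ES] [NormedSpace ℝ ES] {HS : Type*} [TopologicalSpace HS]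
    {IS : ModelWithCorners ℝ ES HS}
    {EX : Type*} [NormedAddCommGroup EX] [NormedSpace ℝ EX] {HX : Type*} [TopologicalSpace HX]
    {IX : ModelWithCorners ℝ EX HX}
    {S : Type*} [TopologicalSpace S] [ChartedSpace HS S]
    {X : Type*} [TopologicalSpace X] [ChartedSpace HX X]

section Homotheties

variable (C : SmoothCone IS IX S X)

theorem contMDiffAt_dil {t : ℝ} (ht : 0 < t) (x : S) :
    ContMDiffAt (𝓘(ℝ, ℝ).prod IS) IS ∞ (fun q : ℝ × S => C.dil q.1 q.2) (t, x) :=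
  C.contMDiffOn_dil.contMDiffAt ((isOpen_Ioi.prod isOpen_univ).mem_nhds ⟨ht, mem_univ x⟩)

theorem contMDiff_dil_comp {h : S → ℝ} (hh : ContMDiff IS 𝓘(ℝ, ℝ) ∞ h) (hpos : ∀ x, 0 < h x) :
    ContMDiff IS IS ∞ fun x => C.dil (h x) x := fun x =>
  ContMDiffAt.comp (f := fun x => (h x, x)) (g := fun q : ℝ × S => C.dil q.1 q.2) x
    (C.contMDiffAt_dil (hpos x) x) ((hh.prodMk contMDiff_id) x)

theorem contMDiff_dil {t : ℝ} (ht : 0 < t) : ContMDiff IS IS ∞ (C.dil t) :=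
  C.contMDiff_dil_comp contMDiff_const fun _ => ht

theorem contMDiffAt_dil_left {t : ℝ} (ht : 0 < t) (x : S) :
    ContMDiffAt 𝓘(ℝ, ℝ) IS ∞ (fun s => C.dil s x) t :=
  ContMDiffAt.comp (f := fun s : ℝ => (s, x)) (g := fun q : ℝ × S => C.dil q.1 q.2) t
    (C.contMDiffAt_dil ht x) ((contMDiff_id.prodMk contMDiff_const) t)

theorem dil_inv_dil {t : ℝ} (ht : 0 < t) (x : S) : C.dil t⁻¹ (C.dil t x) = x := by
  rw [← C.dil_mul _ _ (inv_pos.2 ht) ht, inv_mul_cancel₀ ht.ne', C.dil_one]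

/-- A function on a cone is homogeneous of degree zero if it is invariant under homotheties. -/
def IsDegreeZero {F : Type*} (f : S → F) : Prop :=
  ∀ t, 0 < t → ∀ x, f (C.dil t x) = f x

/-- A radius: a positive smooth function, homogeneous of degree one. -/
structure IsRadius (r : S → ℝ) : Prop where
  contMDiff : ContMDiff IS 𝓘(ℝ, ℝ) ∞ r
  pos : ∀ x, 0 < r x
  map_dil : ∀ t, 0 < t → ∀ x, r (C.dil t x) = t * r x

variable {C}

theorem IsRadius.map_dil_inv {r : S → ℝ} (hr : C.IsRadius r) (x : S) :
    r (C.dil (r x)⁻¹ x) = 1 := by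
  rw [hr.map_dil _ (inv_pos.2 (hr.pos x)), inv_mul_cancel₀ (hr.pos x).ne']

theorem IsRadius.contMDiff_inv {r : S → ℝ} (hr : C.IsRadius r) :
    ContMDiff IS 𝓘(ℝ, ℝ) ∞ fun x => (r x)⁻¹ := fun x =>
  (hr.contMDiff x).inv₀ (hr.pos x).ne'

theorem IsRadius.contMDiff_dil_inv {r : S → ℝ} (hr : C.IsRadius r) :
    ContMDiff IS IS ∞ fun x => C.dil (r x)⁻¹ x :=
  C.contMDiff_dil_comp hr.contMDiff_inv fun x => inv_pos.2 (hr.pos x)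

theorem IsRadius.isDegreeZero_dil_inv {r : S → ℝ} (hr : C.IsRadius r) :
    C.IsDegreeZero fun x => C.dil (r x)⁻¹ x := fun t ht x => by
  change C.dil (r (C.dil t x))⁻¹ (C.dil t x) = C.dil (r x)⁻¹ x
  rw [hr.map_dil t ht, ← C.dil_mul _ _ (inv_pos.2 (mul_pos ht (hr.pos x))) ht, mul_inv_rev,
    inv_mul_cancel_right₀ ht.ne']

end Homotheties

section LocalTrivialization

variable (C : SmoothCone IS IX S X)

/-- A local trivialization of the bundle `S → X` over the open set `U`, as in
`SmoothCone.exists_trivialization`. -/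
structure IsTrivializationOver (U : Set X) (φ : OpenPartialHomeomorph S (X × ℝ)) : Prop where
  isOpen : IsOpen U
  source_eq : φ.source = C.proj ⁻¹' U
  target_eq : φ.target = U ×ˢ Ioi 0
  contMDiffOn : ContMDiffOn IS (IX.prod 𝓘(ℝ, ℝ)) ∞ φ φ.source
  contMDiffOn_symm : ContMDiffOn (IX.prod 𝓘(ℝ, ℝ)) IS ∞ φ.symm φ.target
  fst_apply : ∀ x ∈ φ.source, (φ x).1 = C.proj x
  apply_dil : ∀ x ∈ φ.source, ∀ t, 0 < t → φ (C.dil t x) = (C.proj x, t * (φ x).2)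

theorem exists_isTrivializationOver (b : X) :
    ∃ (U : Set X) (φ : OpenPartialHomeomorph S (X × ℝ)), b ∈ U ∧ C.IsTrivializationOver U φ := by
  obtain ⟨U, φ, hU, hb, hsource, htarget, hφ, hφsymm, hdil⟩ := C.exists_trivialization b
  exact ⟨U, φ, hb, hU, hsource, htarget, hφ, hφsymm, fun x hx => (hdil x hx).1,
    fun x hx => (hdil x hx).2⟩

namespace IsTrivializationOver

variable {C} {U : Set X} {φ : OpenPartialHomeomorph S (X × ℝ)} (hφ : C.IsTrivializationOver U φ)

include hφ

theorem mem_source {x : S} : x ∈ φ.source ↔ C.proj x ∈ U := by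
  rw [hφ.source_eq, mem_preimage]

theorem snd_pos {x : S} (hx : x ∈ φ.source) : 0 < (φ x).2 := by
  have := φ.map_source hx
  rw [hφ.target_eq] at this
  exact this.2

theorem contMDiffAt {x : S} (hx : x ∈ φ.source) : ContMDiffAt IS (IX.prod 𝓘(ℝ, ℝ)) ∞ φ x :=
  hφ.contMDiffOn.contMDiffAt (φ.open_source.mem_nhds hx)

theorem contMDiffAt_snd {x : S} (hx : x ∈ φ.source) :
    ContMDiffAt IS 𝓘(ℝ, ℝ) ∞ (fun y => (φ y).2) x :=
  contMDiff_snd.contMDiffAt.comp x (hφ.contMDiffAt hx)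

theorem contMDiff_mul_snd {p : X → ℝ} (hp : ContMDiff IX 𝓘(ℝ, ℝ) ∞ p) (hpU : tsupport p ⊆ U) :
    ContMDiff IS 𝓘(ℝ, ℝ) ∞ fun x => p (C.proj x) * (φ x).2 := by
  refine contMDiff_of_tsupport fun x hx => ?_
  have hxp : C.proj x ∈ tsupport p :=
    tsupport_comp_subset_preimage p C.contMDiff_proj.continuous (tsupport_mul_subset_left hx)
  exact (hp.comp C.contMDiff_proj x).mul (hφ.contMDiffAt_snd (hφ.mem_source.2 (hpU hxp)))

end IsTrivializationOver

theorem exists_dil_eq_of_proj_eq {x y : S} (hxy : C.proj x = C.proj y) :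
    ∃ t, 0 < t ∧ C.dil t x = y := by
  obtain ⟨U, φ, hxU, hφ⟩ := C.exists_isTrivializationOver (C.proj x)
  have hx : x ∈ φ.source := hφ.mem_source.2 hxU
  have hy : y ∈ φ.source := hφ.mem_source.2 (hxy ▸ hxU)
  have hpos := hφ.snd_pos hx
  have ht : 0 < (φ y).2 / (φ x).2 := div_pos (hφ.snd_pos hy) hpos
  refine ⟨_, ht, φ.injOn (hφ.mem_source.2 (by rwa [C.proj_dil _ ht])) hy ?_⟩
  rw [hφ.apply_dil x hx _ ht, div_mul_cancel₀ _ hpos.ne', hxy, ← hφ.fst_apply y hy]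

variable {C}

theorem IsRadius.eq_of_proj_eq {r : S → ℝ} (hr : C.IsRadius r) {x y : S}
    (hproj : C.proj x = C.proj y) (hxy : r x = r y) : x = y := by
  obtain ⟨t, ht, rfl⟩ := C.exists_dil_eq_of_proj_eq hproj
  rw [hr.map_dil t ht, right_eq_mul₀ (hr.pos x).ne'] at hxy
  rw [hxy, C.dil_one]

end LocalTrivialization

section RadialField

variable {F : Type*} [NormedAddCommGroup F] [NormedSpace ℝ F] (C : SmoothCone IS IX S X)

theorem mfderiv_cast_tangent {M : Type*} [TopologicalSpace M] {H' : Type*} [TopologicalSpace H']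
    {E' : Type*} [NormedAddCommGroup E'] [NormedSpace ℝ E'] {I' : ModelWithCorners ℝ E' H'}
    [ChartedSpace H' M] (f : S → M) {x y : S} (h : y = x) (u : TangentSpace IS y) :
    (mfderiv IS I' f x (cast (congrArg (fun y : S => TangentSpace IS y) h) u) : E')
      = (mfderiv IS I' f y u : E') := by
  subst h
  rfl

theorem mfderiv_radialField {M : Type*} [TopologicalSpace M] {H' : Type*} [TopologicalSpace H']
    {E' : Type*} [NormedAddCommGroup E'] [NormedSpace ℝ E'] {I' : ModelWithCorners ℝ E' H'}
    [ChartedSpace H' M] {f : S → M} {x : S} (hf : MDifferentiableAt IS I' f x) :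
    (mfderiv IS I' f x (C.radialField x) : E')
      = (mfderiv 𝓘(ℝ, ℝ) I' (fun t : ℝ => f (C.dil t x)) 1 (1 : ℝ) : E') := by
  have hdil : MDifferentiableAt 𝓘(ℝ, ℝ) IS (fun t => C.dil t x) 1 :=
    (C.contMDiffAt_dil_left one_pos x).mdifferentiableAt (by simp)
  have hf' : MDifferentiableAt IS I' f (C.dil 1 x) := by rwa [C.dil_one]
  rw [radialField, mfderiv_cast_tangent f (C.dil_one x)]
  change _ = (mfderiv 𝓘(ℝ, ℝ) I' (f ∘ fun t : ℝ => C.dil t x) 1 (1 : ℝ) : E')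
  rw [mfderiv_comp (1 : ℝ) hf' hdil]
  rfl

theorem differential_radialField {f : S → F} {x : S} (hf : MDifferentiableAt IS 𝓘(ℝ, F) f x) :
    differential IS f x (C.radialField x) = deriv (fun t => f (C.dil t x)) 1 := by
  have h := C.mfderiv_radialField hf
  rw [mfderiv_eq_fderiv] at h
  exact h

variable {C}

theorem IsDegreeZero.differential_radialField {f : S → F} (hf : C.IsDegreeZero f) {x : S}
    (hfx : MDifferentiableAt IS 𝓘(ℝ, F) f x) : differential IS f x (C.radialField x) = 0 := by
  have hconst : (fun t => f (C.dil t x)) =ᶠ[𝓝 1] fun _ => f x := by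
    filter_upwards [Ioi_mem_nhds one_pos] with t ht using hf t ht x
  rw [C.differential_radialField hfx, hconst.deriv_eq, deriv_const]

variable (C)

theorem differential_radialField_of_forall_dil {f : S → ℝ} {x : S}
    (hfx : MDifferentiableAt IS 𝓘(ℝ, ℝ) f x) (hf : ∀ t, 0 < t → f (C.dil t x) = t * f x) :
    differential IS f x (C.radialField x) = f x := by
  have hlin : (fun t => f (C.dil t x)) =ᶠ[𝓝 1] fun t => t * f x := by
    filter_upwards [Ioi_mem_nhds one_pos] with t ht using hf t ht
  rw [C.differential_radialField hfx, hlin.deriv_eq, deriv_mul_const_field, deriv_id'', one_mul]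

theorem mfderiv_proj_radialField (x : S) : mfderiv IS IX C.proj x (C.radialField x) = 0 := by
  have h := C.mfderiv_radialField (C.contMDiff_proj.mdifferentiable (by simp) x)
  have hconst : (fun t => C.proj (C.dil t x)) =ᶠ[𝓝 1] fun _ => C.proj x := by
    filter_upwards [Ioi_mem_nhds one_pos] with t ht using C.proj_dil t ht x
  rw [hconst.mfderiv_eq, mfderiv_const] at h
  exact h

variable {C}

theorem IsRadius.differential_radialField {r : S → ℝ} (hr : C.IsRadius r) (x : S) :
    differential IS r x (C.radialField x) = r x :=
  C.differential_radialField_of_forall_dil (hr.contMDiff.mdifferentiable (by simp) x)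
    fun t ht => hr.map_dil t ht x

theorem IsTrivializationOver.eq_zero_of_mfderiv_proj_eq_zero [IsManifold IS ∞ S]
    [IsManifold IX ∞ X] {U : Set X} {φ : OpenPartialHomeomorph S (X × ℝ)}
    (hφ : C.IsTrivializationOver U φ) {x : S} (hx : x ∈ φ.source) {v : TangentSpace IS x}
    (hproj : mfderiv IS IX C.proj x v = 0) (hsnd : differential IS (fun y => (φ y).2) x v = 0) :
    v = 0 := by
  have hφd : φ.MDifferentiable IS (IX.prod 𝓘(ℝ, ℝ)) :=
    ⟨hφ.contMDiffOn.mdifferentiableOn (by simp), hφ.contMDiffOn_symm.mdifferentiableOn (by simp)⟩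
  have hfst : (fun y => (φ y).1) =ᶠ[𝓝 x] C.proj := by
    filter_upwards [φ.open_source.mem_nhds hx] with y hy using hφ.fst_apply y hy
  have hprod : mfderiv IS (IX.prod 𝓘(ℝ, ℝ)) φ x =
      (mfderiv IS IX (fun y => (φ y).1) x).prod (mfderiv IS 𝓘(ℝ, ℝ) (fun y => (φ y).2) x) :=
    mfderiv_prodMk ((contMDiff_fst.contMDiffAt.comp x (hφ.contMDiffAt hx)).mdifferentiableAt
      (by simp)) ((hφ.contMDiffAt_snd hx).mdifferentiableAt (by simp))
  rw [hfst.mfderiv_eq] at hprod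
  refine (injective_iff_map_eq_zero _).1 (hφd.mfderiv_injective hx) v ?_
  rw [hprod]
  exact Prod.ext hproj hsnd

theorem exists_eq_smul_radialField_of_mfderiv_proj_eq_zero [IsManifold IS ∞ S]
    [IsManifold IX ∞ X] {x : S} {v : TangentSpace IS x} (hv : mfderiv IS IX C.proj x v = 0) :
    ∃ c : ℝ, v = c • C.radialField x := by
  obtain ⟨U, φ, hxU, hφ⟩ := C.exists_isTrivializationOver (C.proj x)
  have hx : x ∈ φ.source := hφ.mem_source.2 hxU
  have hsnd : differential IS (fun y => (φ y).2) x (C.radialField x) = (φ x).2 :=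
    C.differential_radialField_of_forall_dil ((hφ.contMDiffAt_snd hx).mdifferentiableAt (by simp))
      fun t ht => by rw [hφ.apply_dil x hx t ht]
  refine ⟨differential IS (fun y => (φ y).2) x v / (φ x).2, sub_eq_zero.1
    (hφ.eq_zero_of_mfderiv_proj_eq_zero hx ?_ ?_)⟩
  · rw [map_sub, map_smul, hv, C.mfderiv_proj_radialField, smul_zero, sub_zero]
  · refine (map_sub (differential IS (fun y => (φ y).2) x) v _).trans (sub_eq_zero.2 ?_)
    refine .trans ?_ (map_smul (differential IS (fun y => (φ y).2) x) _ _).symm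
    rw [hsnd, smul_eq_mul, div_mul_cancel₀ _ (hφ.snd_pos hx).ne']
    rfl

theorem IsRadius.eq_zero_of_mfderiv_proj_eq_zero [IsManifold IS ∞ S] [IsManifold IX ∞ X]
    {r : S → ℝ} (hr : C.IsRadius r) {x : S} {v : TangentSpace IS x}
    (hv : mfderiv IS IX C.proj x v = 0) (hrv : differential IS r x v = 0) : v = 0 := by
  obtain ⟨c, rfl⟩ := exists_eq_smul_radialField_of_mfderiv_proj_eq_zero hv
  have hc : c * r x = 0 := by
    rw [← hr.differential_radialField, ← smul_eq_mul]
    exact (map_smul (differential IS r x) c _).symm.trans hrv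
  rw [(mul_eq_zero.1 hc).resolve_right (hr.pos x).ne', zero_smul]

end RadialField

section LieDerivative

variable [IsManifold IS ∞ S] {C : SmoothCone IS IX S X} {w : SmoothOneForm IS S}
  (hw : C.HasRadialLieDeriv w w)

include hw

theorem hasDerivAt_pullbackOneForm_dil_exp (x : S) (v : TangentSpace IS x) (s : ℝ) :
    HasDerivAt (fun s => pullbackOneForm (C.dil (Real.exp s)) w x v)
      (pullbackOneForm (C.dil (Real.exp s)) w x v) s := by
  have hadd (u : ℝ) : pullbackOneForm (C.dil (Real.exp (s + u))) w x v =
      pullbackOneForm (C.dil (Real.exp u)) w (C.dil (Real.exp s) x)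
        (mfderiv IS IS (C.dil (Real.exp s)) x v) := by
    have hcomp : C.dil (Real.exp (s + u)) = C.dil (Real.exp u) ∘ C.dil (Real.exp s) := by
      funext y
      rw [add_comm, Real.exp_add, C.dil_mul _ _ (Real.exp_pos _) (Real.exp_pos _)]
      rfl
    rw [hcomp, pullbackOneForm_comp w
      ((C.contMDiff_dil (Real.exp_pos _)).mdifferentiable (by simp) _)
      ((C.contMDiff_dil (Real.exp_pos _)).mdifferentiable (by simp) _)]
  have hflow := hw (C.dil (Real.exp s) x) (mfderiv IS IS (C.dil (Real.exp s)) x v)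
  simp only [← hadd] at hflow
  rw [← sub_self s] at hflow
  have hshift := hflow.comp_sub_const s s
  simp only [add_sub_cancel] at hshift
  exact hshift

theorem pullbackOneForm_dil {t : ℝ} (ht : 0 < t) (x : S) (v : TangentSpace IS x) :
    pullbackOneForm (C.dil t) w x v = t * w x v := by
  set h : ℝ → ℝ := fun s => pullbackOneForm (C.dil (Real.exp s)) w x v with hdef
  have hderiv (s : ℝ) : HasDerivAt (fun s => h s * Real.exp (-s)) 0 s := by
    refine ((hasDerivAt_pullbackOneForm_dil_exp hw x v s).mul
      (hasDerivAt_neg s).exp).congr_deriv ?_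
    ring
  have h0 : h 0 = w x v := by
    have hid : C.dil (Real.exp 0) = id := by
      funext y
      rw [Real.exp_zero, C.dil_one, id]
    simp only [hdef, hid, pullbackOneForm_id]
  have hconst := is_const_of_deriv_eq_zero (fun s => (hderiv s).differentiableAt)
    (fun s => (hderiv s).deriv) (Real.log t) 0
  simp only [neg_zero, Real.exp_zero, mul_one, h0, Real.exp_neg, Real.exp_log ht] at hconst
  rw [← hconst, mul_comm, mul_assoc, inv_mul_cancel₀ ht.ne', mul_one]
  simp only [hdef, Real.exp_log ht]

end LieDerivative

section CompactBase

variable [CompactSpace X] [T2Space X] (C : SmoothCone IS IX S X)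

theorem exists_isRadius [FiniteDimensional ℝ EX] [IsManifold IX ∞ X] : ∃ r, C.IsRadius r := by
  choose U φ hbU hφ using C.exists_isTrivializationOver
  obtain ⟨T, hT⟩ := isCompact_univ.elim_finite_subcover U (fun b => (hφ b).isOpen)
    fun b _ => mem_iUnion.2 ⟨b, hbU b⟩
  obtain ⟨p, hp⟩ := SmoothPartitionOfUnity.exists_isSubordinate IX (isClosed_univ (X := X))
    (fun b : T => U b) (fun b => (hφ b).isOpen) (by rwa [iUnion_subtype])
  have hmem {b : T} {x : S} (h : p b (C.proj x) ≠ 0) : x ∈ (φ b).source :=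
    (hφ b).mem_source.2 (hp b (subset_tsupport _ h))
  refine ⟨fun x => ∑ b : T, p b (C.proj x) * (φ b x).2, ?_, fun x => ?_, fun t ht x => ?_⟩
  · exact contMDiff_finsetSum fun b _ => (hφ b).contMDiff_mul_snd (p b).contMDiff (hp b)
  · obtain ⟨b, hb⟩ := p.exists_pos_of_mem (mem_univ (C.proj x))
    refine Finset.sum_pos' (fun c _ => ?_)
      ⟨b, Finset.mem_univ b, mul_pos hb ((hφ b).snd_pos (hmem hb.ne'))⟩
    rcases eq_or_ne (p c (C.proj x)) 0 with hc | hc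
    · rw [hc, zero_mul]
    · exact mul_nonneg (p.nonneg c _) ((hφ c).snd_pos (hmem hc)).le
  · rw [Finset.mul_sum]
    refine Finset.sum_congr rfl fun b _ => ?_
    rw [C.proj_dil t ht]
    rcases eq_or_ne (p b (C.proj x)) 0 with hb | hb
    · rw [hb, zero_mul, zero_mul, mul_zero]
    · rw [(hφ b).apply_dil x (hmem hb) t ht, mul_left_comm]

theorem exists_isCompact_image_proj_eq_univ : ∃ K : Set S, IsCompact K ∧ C.proj '' K = univ := by
  suffices h : ∃ K : Set S, IsCompact K ∧ univ ⊆ C.proj '' K by simpa only [univ_subset_iff] using h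
  refine isCompact_univ.induction_on ⟨∅, isCompact_empty, empty_subset _⟩
    (fun A B hAB ⟨K, hK, hBK⟩ => ⟨K, hK, hAB.trans hBK⟩)
    (fun A B ⟨K, hK, hAK⟩ ⟨L, hL, hBL⟩ => ⟨K ∪ L, hK.union hL, ?_⟩) fun b _ => ?_
  · rw [image_union]
    exact union_subset_union hAK hBL
  · obtain ⟨U, φ, hbU, hφ⟩ := C.exists_isTrivializationOver b
    obtain ⟨A, hA, hAU, hAc⟩ := local_compact_nhds (hφ.isOpen.mem_nhds hbU)
    have hmem : A ×ˢ {1} ⊆ φ.target := by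
      rw [hφ.target_eq]
      exact prod_mono hAU (singleton_subset_iff.2 (mem_Ioi.2 one_pos))
    refine ⟨A, mem_nhdsWithin_of_mem_nhds hA, φ.symm '' (A ×ˢ {1}),
      (hAc.prod isCompact_singleton).image_of_continuousOn (φ.continuousOn_symm.mono hmem),
      fun q hq => ?_⟩
    have ht : (q, (1 : ℝ)) ∈ φ.target := hmem ⟨hq, rfl⟩
    refine ⟨φ.symm (q, 1), mem_image_of_mem _ ⟨hq, rfl⟩, ?_⟩
    rw [← hφ.fst_apply _ (φ.map_target ht), φ.right_inv ht]

include C in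
theorem sigmaCompactSpace : SigmaCompactSpace S := by
  obtain ⟨K, hK, hKX⟩ := C.exists_isCompact_image_proj_eq_univ
  have : CompactSpace K := isCompact_iff_compactSpace.1 hK
  have hcont : Continuous fun q : ℝ × K => C.dil (Real.exp q.1) q.2 :=
    C.contMDiffOn_dil.continuousOn.comp_continuous (f := fun q : ℝ × K => (Real.exp q.1, (q.2 : S)))
      (by fun_prop) fun q => ⟨Real.exp_pos _, mem_univ _⟩
  rw [← isSigmaCompact_univ_iff]
  convert isSigmaCompact_range hcont
  refine (eq_univ_of_forall fun x => ?_).symm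
  obtain ⟨k, hk, hkx⟩ := (hKX ▸ mem_univ (C.proj x) : C.proj x ∈ C.proj '' K)
  obtain ⟨t, ht, rfl⟩ := C.exists_dil_eq_of_proj_eq hkx
  exact ⟨(Real.log t, ⟨k, hk⟩), by simp only [Real.exp_log ht]⟩

variable {C}

theorem IsRadius.isCompact_setOf_eq_one {r : S → ℝ} (hr : C.IsRadius r) :
    IsCompact {x | r x = 1} := by
  obtain ⟨K, hK, hKX⟩ := C.exists_isCompact_image_proj_eq_univ
  convert hK.image hr.contMDiff_dil_inv.continuous
  refine Subset.antisymm (fun x hx => ?_) (image_subset_iff.2 fun k _ => hr.map_dil_inv k)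
  obtain ⟨k, hk, hkx⟩ := (hKX ▸ mem_univ (C.proj x) : C.proj x ∈ C.proj '' K)
  refine ⟨k, hk, hr.eq_of_proj_eq ?_ ((hr.map_dil_inv k).trans (Eq.symm hx))⟩
  rw [C.proj_dil _ (inv_pos.2 (hr.pos k)), hkx]

theorem IsRadius.exists_isDegreeZero_injective_immersion [FiniteDimensional ℝ EX]
    [IsManifold IX ∞ X] [IsManifold IS ∞ S] {r : S → ℝ} (hr : C.IsRadius r) :
    ∃ (N : ℕ) (f : S → EuclideanSpace ℝ (Fin N)),
      ContMDiff IS 𝓘(ℝ, EuclideanSpace ℝ (Fin N)) ∞ f ∧ C.IsDegreeZero f ∧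
      (Function.Injective fun x => (r x, f x)) ∧
      ∀ x, Function.Injective (differential IS (fun x => (r x, f x)) x) := by
  obtain ⟨N, e, he, hemb, hinj⟩ := exists_embedding_euclidean_of_compact (I := IX) (M := X)
  have hf : ContMDiff IS 𝓘(ℝ, EuclideanSpace ℝ (Fin N)) ∞ fun x => e (C.proj x) :=
    he.comp C.contMDiff_proj
  refine ⟨N, fun x => e (C.proj x), hf, fun t ht x => by simp only [C.proj_dil t ht],
    fun x y hxy => ?_, fun x => (injective_iff_map_eq_zero _).2 fun v hv => ?_⟩
  · exact hr.eq_of_proj_eq (hemb.injective (congrArg Prod.snd hxy)) (congrArg Prod.fst hxy)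
  · rw [differential_prodMk (hr.contMDiff.mdifferentiable (by simp) x)
      (hf.mdifferentiable (by simp) x)] at hv
    refine hr.eq_zero_of_mfderiv_proj_eq_zero
      ((injective_iff_map_eq_zero _).1 (hinj (C.proj x)) _ ?_) (congrArg Prod.fst hv)
    have hchain : mfderiv IS 𝓘(ℝ, EuclideanSpace ℝ (Fin N)) (e ∘ C.proj) x = _ :=
      mfderiv_comp x (he.mdifferentiable (by simp) _) (C.contMDiff_proj.mdifferentiable (by simp) x)
    exact (congrArg (fun L : ES →L[ℝ] EuclideanSpace ℝ (Fin N) => L v) hchain).symm.trans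
      (congrArg Prod.snd hv)

end CompactBase

end SmoothCone

/-- A continuous orthogonal representation in matrix form. -/
structure IsOrthogonalMatrixRep {G : Type*} [Group G] [TopologicalSpace G] {ι : Type*} [Fintype ι]
    [DecidableEq ι] (M : G → Matrix ι ι ℝ) : Prop where
  map_one : M 1 = 1
  map_mul : ∀ g h, M (g * h) = M g * M h
  transpose : ∀ g, (M g).transpose = M g⁻¹
  continuous : Continuous M

namespace IsOrthogonalMatrixRep

variable {G : Type*} [Group G] [TopologicalSpace G] {ι : Type*} [Fintype ι] [DecidableEq ι]
  {M : G → Matrix ι ι ℝ}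

theorem mul_transpose_self (hM : IsOrthogonalMatrixRep M) (g : G) :
    M g * (M g).transpose = 1 := by
  rw [hM.transpose, ← hM.map_mul, mul_inv_cancel, hM.map_one]

theorem dotProduct_mulVec (hM : IsOrthogonalMatrixRep M) (g : G) (u v : ι → ℝ) :
    (M g).mulVec u ⬝ᵥ (M g).mulVec v = u ⬝ᵥ v := by
  rw [Matrix.dotProduct_mulVec, Matrix.vecMul_mulVec, hM.transpose, ← hM.map_mul, inv_mul_cancel,
    hM.map_one, Matrix.vecMul_one]

theorem blockDiagonal (hM : IsOrthogonalMatrixRep M) (κ : Type*) [Fintype κ] [DecidableEq κ] :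
    IsOrthogonalMatrixRep fun g => Matrix.blockDiagonal fun _ : κ => M g where
  map_one := by
    simp only [hM.map_one]
    exact Matrix.blockDiagonal_one
  map_mul g h := by
    rw [← Matrix.blockDiagonal_mul]
    simp only [hM.map_mul]
  transpose g := by
    rw [Matrix.blockDiagonal_transpose]
    simp only [hM.transpose]
  continuous := Continuous.matrix_blockDiagonal (continuous_pi fun _ => hM.continuous)

theorem fromBlocks_one (hM : IsOrthogonalMatrixRep M) (κ : Type*) [Fintype κ] [DecidableEq κ] :
    IsOrthogonalMatrixRep fun g => Matrix.fromBlocks (M g) 0 0 (1 : Matrix κ κ ℝ) where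
  map_one := by rw [hM.map_one, Matrix.fromBlocks_one]
  map_mul g h := by simp [Matrix.fromBlocks_multiply, hM.map_mul]
  transpose g := by simp [Matrix.fromBlocks_transpose, hM.transpose]
  continuous := hM.continuous.matrix_fromBlocks continuous_const continuous_const continuous_const

theorem reindex (hM : IsOrthogonalMatrixRep M) {κ : Type*} [Fintype κ] [DecidableEq κ]
    (e : ι ≃ κ) : IsOrthogonalMatrixRep fun g => (M g).submatrix e.symm e.symm where
  map_one := by rw [hM.map_one, Matrix.submatrix_one_equiv]
  map_mul g h := by rw [Matrix.submatrix_mul_equiv, hM.map_mul]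
  transpose g := by rw [Matrix.transpose_submatrix, hM.transpose]
  continuous := hM.continuous.matrix_submatrix _ _

/-- The homomorphism to the orthogonal group given by an orthogonal representation in matrix
form. -/
def toMonoidHom (hM : IsOrthogonalMatrixRep M) : G →* Matrix.orthogonalGroup ι ℝ where
  toFun g := ⟨M g, (Matrix.mem_orthogonalGroup_iff ι ℝ).2 (hM.mul_transpose_self g)⟩
  map_one' := Subtype.ext hM.map_one
  map_mul' g h := Subtype.ext (hM.map_mul g h)

theorem continuous_toMonoidHom (hM : IsOrthogonalMatrixRep M) : Continuous hM.toMonoidHom :=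
  hM.continuous.subtype_mk _

end IsOrthogonalMatrixRep

section MatrixCoefficients

variable {G : Type*} [Group G] {H : Type*} [NormedAddCommGroup H] [InnerProductSpace ℝ H]
  {V : Submodule ℝ H} {ι : Type*} [Fintype ι]

theorem inner_map_eq_inner_inv_map (τ : G →* (H ≃ₗᵢ[ℝ] H)) (g : G) (u v : H) :
    inner ℝ u (τ g v) = inner ℝ (τ g⁻¹ u) v := by
  rw [← LinearIsometryEquiv.inner_map_map (τ g) (τ g⁻¹ u) v, map_inv]
  exact congrArg (inner ℝ · _) ((τ g).apply_symm_apply u).symm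

theorem sum_inner_smul_coe_orthonormalBasis (b : OrthonormalBasis ι ℝ V) {u : H} (hu : u ∈ V) :
    ∑ i, (inner ℝ (b i : H) u) • (b i : H) = u := by
  simpa using congrArg Subtype.val (b.sum_repr' ⟨u, hu⟩)

theorem map_eq_zero_of_forall_orthonormalBasis {F : Type*} [AddCommGroup F] [Module ℝ F]
    (b : OrthonormalBasis ι ℝ V) {L : H →ₗ[ℝ] F} (hL : ∀ i, L (b i) = 0) {u : H} (hu : u ∈ V) :
    L u = 0 := by
  rw [← sum_inner_smul_coe_orthonormalBasis b hu, map_sum]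
  exact Finset.sum_eq_zero fun i _ => by rw [map_smul, hL, smul_zero]

/-- The matrices of a representation on a subspace `V`, in an orthonormal basis of `V`. -/
noncomputable def matrixCoefficients (τ : G →* (H ≃ₗᵢ[ℝ] H)) (b : OrthonormalBasis ι ℝ V) (g : G) :
    Matrix ι ι ℝ :=
  Matrix.of fun i j => inner ℝ (b i : H) (τ g (b j))

variable {τ : G →* (H ≃ₗᵢ[ℝ] H)} (hV : ∀ g, ∀ u ∈ V, τ g u ∈ V) (b : OrthonormalBasis ι ℝ V)

include hV in
theorem map_orthonormalBasis_eq_sum (g : G) (j : ι) :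
    τ g (b j) = ∑ i, matrixCoefficients τ b g i j • (b i : H) :=
  (sum_inner_smul_coe_orthonormalBasis b (hV g _ (b j).2)).symm

include hV in
theorem isOrthogonalMatrixRep_matrixCoefficients [TopologicalSpace G] [DecidableEq ι]
    (hτ : ∀ u, Continuous fun g => τ g u) : IsOrthogonalMatrixRep (matrixCoefficients τ b) where
  map_one := by
    ext i j
    rw [matrixCoefficients, map_one, Matrix.one_apply]
    exact orthonormal_iff_ite.1 b.orthonormal i j
  map_mul g h := by
    ext i k
    rw [Matrix.mul_apply]
    change inner ℝ (b i : H) (τ (g * h) (b k)) = _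
    rw [map_mul, LinearIsometryEquiv.coe_mul, Function.comp_apply,
      map_orthonormalBasis_eq_sum hV b h k, map_sum, inner_sum]
    exact Finset.sum_congr rfl fun j _ => by
      rw [map_smul, real_inner_smul_right, mul_comm]
      rfl
  transpose g := by
    ext i j
    exact (inner_map_eq_inner_inv_map τ g _ _).trans (real_inner_comm _ _)
  continuous := continuous_matrix fun _ _ => continuous_const.inner (hτ _)

end MatrixCoefficients

section WeightedIntegral

open MeasureTheory

theorem integrable_coe_Lp_two {G : Type*} [MeasurableSpace G] (μ : Measure G) [IsFiniteMeasure μ]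
    (u : Lp ℝ 2 μ) : Integrable u μ :=
  (Lp.memLp u).integrable (by norm_num)

variable {G : Type*} [TopologicalSpace G] [CompactSpace G] [SecondCountableTopology G]
  [MeasurableSpace G] [BorelSpace G] (μ : Measure G) [IsFiniteMeasure μ]
  {F : Type*} [NormedAddCommGroup F] [NormedSpace ℝ F]

/-- The integral of a continuous function on `G`, as a linear function of the square integrable
weight. -/
noncomputable def weightedIntegral (D : C(G, F)) : Lp ℝ 2 μ →ₗ[ℝ] F where
  toFun u := ∫ g, u g • D g ∂μ
  map_add' u u' := by
    rw [← integral_add (integrable_smul_of_continuous (integrable_coe_Lp_two μ u) D.continuous)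
      (integrable_smul_of_continuous (integrable_coe_Lp_two μ u') D.continuous)]
    refine integral_congr_ae ?_
    filter_upwards [Lp.coeFn_add u u'] with g hg
    rw [hg, Pi.add_apply, add_smul]
  map_smul' a u := by
    rw [RingHom.id_apply, ← integral_smul]
    refine integral_congr_ae ?_
    filter_upwards [Lp.coeFn_smul a u] with g hg
    rw [hg, Pi.smul_apply, smul_assoc]

theorem weightedIntegral_sub (D D' : C(G, F)) (u : Lp ℝ 2 μ) :
    weightedIntegral μ (D - D') u = weightedIntegral μ D u - weightedIntegral μ D' u := by
  have hint := fun D : C(G, F) =>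
    integrable_smul_of_continuous (integrable_coe_Lp_two μ u) D.continuous
  exact (integral_congr_ae (.of_forall fun g => smul_sub _ _ _)).trans
    (integral_sub (hint D) (hint D'))

theorem weightedIntegral_eq_inner (D : C(G, ℝ)) (u : Lp ℝ 2 μ) :
    weightedIntegral μ D u = inner ℝ u (ContinuousMap.toLp 2 μ ℝ D) := by
  rw [L2.inner_def]
  refine integral_congr_ae ?_
  filter_upwards [ContinuousMap.coeFn_toLp (𝕜 := ℝ) μ (p := 2) D] with g hg
  rw [hg, smul_eq_mul, mul_comm]
  rfl

theorem clm_weightedIntegral [CompleteSpace F] (φ : F →L[ℝ] ℝ) (D : C(G, F)) (u : Lp ℝ 2 μ) :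
    φ (weightedIntegral μ D u) = weightedIntegral μ ((φ : C(F, ℝ)).comp D) u := by
  change φ (∫ g, u g • D g ∂μ) = ∫ g, u g • φ (D g) ∂μ
  rw [← φ.integral_comp_comm
    (integrable_smul_of_continuous (integrable_coe_Lp_two μ u) D.continuous)]
  simp only [map_smul]

end WeightedIntegral

section LeftRegular

open MeasureTheory DomMulAct

variable {G : Type*} [Group G] [TopologicalSpace G] [IsTopologicalGroup G]
  [SecondCountableTopology G] [MeasurableSpace G] [BorelSpace G]
  (μ : Measure G) [IsFiniteMeasure μ] [μ.IsMulLeftInvariant]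

/-- The left regular representation on square integrable functions. -/
noncomputable def leftRegular : G →* (Lp ℝ 2 μ ≃ₗᵢ[ℝ] Lp ℝ 2 μ) where
  toFun g :=
    { toFun := fun u => mk g⁻¹ • u
      invFun := fun u => mk g • u
      map_add' := fun u v => smul_add _ u v
      map_smul' := fun c u => smul_comm _ c u
      left_inv := fun u => by
        change mk g • mk g⁻¹ • u = u
        rw [smul_smul, ← mk_mul, inv_mul_cancel, mk_one, one_smul]
      right_inv := fun u => by
        change mk g⁻¹ • mk g • u = u
        rw [smul_smul, ← mk_mul, mul_inv_cancel, mk_one, one_smul]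
      norm_map' := fun u => norm_smul_Lp _ u }
  map_one' := by
    ext1 u
    change mk (1 : G)⁻¹ • u = u
    rw [inv_one, mk_one, one_smul]
  map_mul' g h := by
    ext1 u
    change mk (g * h)⁻¹ • u = mk g⁻¹ • mk h⁻¹ • u
    rw [smul_smul, ← mk_mul, mul_inv_rev]

theorem leftRegular_ae_eq (g : G) (u : Lp ℝ 2 μ) :
    leftRegular μ g u =ᵐ[μ] fun h => u (g⁻¹ * h) :=
  smul_Lp_ae_eq (mk g⁻¹) u

theorem continuous_leftRegular [CompactSpace G] [T2Space G] (u : Lp ℝ 2 μ) :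
    Continuous fun g => leftRegular μ g u := by
  have : Fact ((2 : ENNReal) ≠ ⊤) := ⟨by simp⟩
  change Continuous fun g : G => mk g⁻¹ • u
  exact (continuous_mk.comp continuous_inv).smul continuous_const

/-- Finite-dimensional subspaces invariant under the left regular representation. -/
structure IsFiniteInvariant (V : Submodule ℝ (Lp ℝ 2 μ)) : Prop where
  finiteDimensional : FiniteDimensional ℝ V
  map_mem : ∀ g, ∀ u ∈ V, leftRegular μ g u ∈ V

variable {μ} in
theorem isFiniteInvariant_bot : IsFiniteInvariant μ ⊥ where
  finiteDimensional := inferInstance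
  map_mem g u hu := by
    rw [Submodule.mem_bot] at hu ⊢
    rw [hu, map_zero]

variable {μ} in
theorem IsFiniteInvariant.sup {V V' : Submodule ℝ (Lp ℝ 2 μ)}
    (h : IsFiniteInvariant μ V) (h' : IsFiniteInvariant μ V') : IsFiniteInvariant μ (V ⊔ V') where
  finiteDimensional := by
    have := h.finiteDimensional
    have := h'.finiteDimensional
    infer_instance
  map_mem g u hu := by
    obtain ⟨a, ha, b, hb, rfl⟩ := Submodule.mem_sup.1 hu
    rw [map_add]
    exact Submodule.add_mem_sup (h.map_mem g a ha) (h'.map_mem g b hb)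

theorem IsFiniteInvariant.exists_forall_mem_of_isCompact {T : Type*}
    [TopologicalSpace T] {p : Submodule ℝ (Lp ℝ 2 μ) → T → Prop} (hp : ∀ x, Monotone fun V => p V x)
    {K : Set T} (hK : IsCompact K)
    (hloc : ∀ x ∈ K, ∃ V, IsFiniteInvariant μ V ∧ ∀ᶠ y in 𝓝 x, p V y) :
    ∃ V, IsFiniteInvariant μ V ∧ ∀ x ∈ K, p V x := by
  refine hK.induction_on (p := fun s => ∃ V, IsFiniteInvariant μ V ∧ ∀ x ∈ s, p V x)
    ⟨⊥, isFiniteInvariant_bot, by simp⟩ ?_ ?_ fun x hx => ?_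
  · rintro s t hst ⟨V, hV, h⟩
    exact ⟨V, hV, fun x hx => h x (hst hx)⟩
  · rintro s t ⟨V, hV, h⟩ ⟨V', hV', h'⟩
    exact ⟨V ⊔ V', hV.sup hV', fun x hx => hx.elim (fun hx => hp x le_sup_left (h x hx))
      fun hx => hp x le_sup_right (h' x hx)⟩
  · obtain ⟨V, hV, h⟩ := hloc x hx
    exact ⟨_, mem_nhdsWithin_of_mem_nhds h, V, hV, fun y hy => hy⟩

variable [CompactSpace G] {F : Type*} [NormedAddCommGroup F] [NormedSpace ℝ F]

theorem weightedIntegral_leftRegular (g : G) (D : C(G, F)) (u : Lp ℝ 2 μ) :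
    weightedIntegral μ D (leftRegular μ g u)
      = weightedIntegral μ (D.comp (ContinuousMap.mulLeft g)) u := by
  change ∫ h, leftRegular μ g u h • D h ∂μ = ∫ h, u h • D (g * h) ∂μ
  rw [← integral_mul_left_eq_self (fun h => u (g⁻¹ * h) • D h) g |>.trans (integral_congr_ae ?_)]
  · simp only [inv_mul_cancel_left]
  · filter_upwards [leftRegular_ae_eq μ g u] with h hh
    rw [hh]

end LeftRegular

open MeasureTheory in
/-- The Peter–Weyl theorem, in the weak form that finite-dimensional invariant subspaces detect
nonzero continuous functions. -/
theorem exists_isFiniteInvariant_weightedIntegral_ne_zero {G : Type*} [Group G]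
    [TopologicalSpace G] [IsTopologicalGroup G] [CompactSpace G] [T2Space G]
    [SecondCountableTopology G] [MeasurableSpace G] [BorelSpace G] (μ : Measure G)
    [IsProbabilityMeasure μ] [μ.IsMulLeftInvariant] [μ.IsOpenPosMeasure] {F : Type*}
    [NormedAddCommGroup F] [NormedSpace ℝ F] [CompleteSpace F] {D : C(G, F)} (hD : D ≠ 0) :
    ∃ V, IsFiniteInvariant μ V ∧ ∃ e ∈ V, weightedIntegral μ D e ≠ 0 := by
  obtain ⟨g, hg⟩ := DFunLike.ne_iff.1 hD
  obtain ⟨φ, hφ⟩ := SeparatingDual.exists_ne_zero (R := ℝ) hg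
  have hφD : ContinuousMap.toLp 2 μ ℝ ((φ : C(F, ℝ)).comp D) ≠ 0 := by
    rw [← map_zero (ContinuousMap.toLp 2 μ ℝ)]
    exact (ContinuousMap.toLp_injective μ).ne fun h => hφ (DFunLike.congr_fun h g)
  obtain ⟨V, hfin, hinv, e, he, hne⟩ := exists_finiteDimensional_invariant_inner_ne_zero μ
    (continuous_leftRegular μ) _ hφD
  refine ⟨V, ⟨hfin, hinv⟩, e, he, fun h => hne ?_⟩
  rw [← weightedIntegral_eq_inner, ← clm_weightedIntegral, h, map_zero]

section OrbitIntegral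

open MeasureTheory

variable {EG : Type*} [NormedAddCommGroup EG] [NormedSpace ℝ EG]
  {G : Type*} [Group G] [TopologicalSpace G] [ChartedSpace EG G] [LieGroup 𝓘(ℝ, EG) ∞ G]
  {ES : Type*} [NormedAddCommGroup ES] [NormedSpace ℝ ES]
  {HS : Type*} [TopologicalSpace HS] {IS : ModelWithCorners ℝ ES HS}
  {S : Type*} [TopologicalSpace S] [ChartedSpace HS S]
  {F : Type*} [NormedAddCommGroup F] [NormedSpace ℝ F]
  [MulAction G S]

/-- The integral of a function along the orbits of a group action, against a weight. -/
noncomputable def orbitIntegral [MeasurableSpace G] (μ : Measure G) (c : G → ℝ) (f : S → F)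
    (x : S) : F :=
  ∫ g, c g • f (g⁻¹ • x) ∂μ

variable [ContMDiffSMul 𝓘(ℝ, EG) IS ∞ G S]

variable (EG) in
theorem contMDiff_uncurry_inv_smul {f : S → F} (hf : ContMDiff IS 𝓘(ℝ, F) ∞ f) :
    ContMDiff (𝓘(ℝ, EG).prod IS) 𝓘(ℝ, F) ∞ (Function.uncurry fun (g : G) x => f (g⁻¹ • x)) := by
  have hsmul : ContMDiff (𝓘(ℝ, EG).prod IS) IS ∞ (fun p : G × S => p.1⁻¹ • p.2) :=
    (contMDiff_smul (I := 𝓘(ℝ, EG)) (I' := IS)).comp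
      (((contMDiff_inv 𝓘(ℝ, EG) ∞).comp contMDiff_fst).prodMk contMDiff_snd)
  exact hf.comp hsmul

variable (EG G) in
/-- The restriction of a smooth function to an orbit. -/
noncomputable def orbitMap {f : S → F} (hf : ContMDiff IS 𝓘(ℝ, F) ∞ f) (x : S) : C(G, F) where
  toFun g := f (g⁻¹ • x)
  continuous_toFun := (contMDiff_uncurry_inv_smul EG hf).continuous.comp
    (continuous_id.prodMk continuous_const)

variable [IsManifold IS ∞ S]

variable (EG G) in
/-- The derivative of a smooth function along an orbit, in the direction of the translates of a
tangent vector. -/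
noncomputable def orbitDifferential {f : S → F} (hf : ContMDiff IS 𝓘(ℝ, F) ∞ f) (x : S) (v : ES) :
    C(G, F) where
  toFun g := differential IS (fun y => f (g⁻¹ • y)) x v
  continuous_toFun := (continuous_differential_of_contMDiff_uncurry
    (contMDiff_uncurry_inv_smul EG hf) x).clm_apply continuous_const

variable [CompactSpace G] [SecondCountableTopology G] [MeasurableSpace G] [BorelSpace G]
  {μ : Measure G} [FiniteDimensional ℝ ES] [CompleteSpace F]

include EG in
variable (EG) in
theorem contMDiff_orbitIntegral {c : G → ℝ} (hc : Integrable c μ) {f : S → F}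
    (hf : ContMDiff IS 𝓘(ℝ, F) ∞ f) : ContMDiff IS 𝓘(ℝ, F) ∞ (orbitIntegral μ c f) :=
  contMDiff_integral_smul (contMDiff_uncurry_inv_smul EG hf) hc

theorem differential_orbitIntegral [IsFiniteMeasure μ] {f : S → F}
    (hf : ContMDiff IS 𝓘(ℝ, F) ∞ f) (x : S) (v : ES) (u : Lp ℝ 2 μ) :
    differential IS (orbitIntegral μ u f) x v
      = weightedIntegral μ (orbitDifferential EG G hf x v) u :=
  differential_integral_smul_apply (contMDiff_uncurry_inv_smul EG hf) (integrable_coe_Lp_two μ u)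
    x v

end OrbitIntegral

section OrbitCoordinates

open MeasureTheory

variable {EG : Type*} [NormedAddCommGroup EG] [NormedSpace ℝ EG]
  {G : Type*} [Group G] [MeasurableSpace G] {μ : Measure G} {S : Type*} [MulAction G S]
  {F : Type*} [NormedAddCommGroup F] [NormedSpace ℝ F]
  {V V' : Submodule ℝ (Lp ℝ 2 μ)} {f : S → F} {ι : Type*}

/-- The orbit integrals with weights in `V` distinguish `x` and `y`. -/
def OrbitSeparates (V : Submodule ℝ (Lp ℝ 2 μ)) (f : S → F) (x y : S) : Prop :=
  (∀ e ∈ V, orbitIntegral μ e f x = orbitIntegral μ e f y) → x = y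

theorem OrbitSeparates.mono {x y : S} (h : OrbitSeparates V f x y) (hV : V ≤ V') :
    OrbitSeparates V' f x y :=
  fun hf => h fun e he => hf e (hV he)

/-- The orbit integrals with weights in a finite family. -/
noncomputable def orbitCoordinates (e : ι → Lp ℝ 2 μ) (f : S → F) (x : S) (i : ι) : F :=
  orbitIntegral μ (e i) f x

variable {ES : Type*} [NormedAddCommGroup ES] [NormedSpace ℝ ES]
  {HS : Type*} [TopologicalSpace HS] {IS : ModelWithCorners ℝ ES HS}
  [TopologicalSpace S] [ChartedSpace HS S]

variable (IS) in
/-- The tangent vectors annihilated by the differentials of all orbit integrals with weights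
in `V`. -/
noncomputable def orbitKernel (V : Submodule ℝ (Lp ℝ 2 μ)) (f : S → F) (x : S) :
    Submodule ℝ ES :=
  ⨅ e ∈ V, (differential IS (orbitIntegral μ e f) x).ker

theorem mem_orbitKernel {x : S} {v : ES} :
    v ∈ orbitKernel IS V f x ↔ ∀ e ∈ V, differential IS (orbitIntegral μ e f) x v = 0 := by
  simp only [orbitKernel, Submodule.mem_iInf]
  rfl

theorem orbitKernel_anti (hV : V ≤ V') (x : S) : orbitKernel IS V' f x ≤ orbitKernel IS V f x :=
  fun _ hv => mem_orbitKernel.2 fun e he => mem_orbitKernel.1 hv e (hV he)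

variable [TopologicalSpace G] [ChartedSpace EG G] [LieGroup 𝓘(ℝ, EG) ∞ G]
  [CompactSpace G] [SecondCountableTopology G] [BorelSpace G]
  [ContMDiffSMul 𝓘(ℝ, EG) IS ∞ G S]

section Basis

variable [IsFiniteMeasure μ] [Fintype ι] (b : OrthonormalBasis ι ℝ V)

include EG in
variable (EG) in
theorem orbitSeparates_iff_orbitCoordinates (hf : ContMDiff IS 𝓘(ℝ, F) ∞ f) {x y : S} :
    OrbitSeparates V f x y ↔ (orbitCoordinates (fun i => (b i : Lp ℝ 2 μ)) f x
      = orbitCoordinates (fun i => (b i : Lp ℝ 2 μ)) f y → x = y) := by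
  refine imp_congr_left ⟨fun h => funext fun i => h _ (b i).2, fun h e he => ?_⟩
  let L := weightedIntegral μ (orbitMap EG G hf x) - weightedIntegral μ (orbitMap EG G hf y)
  have hL : ∀ i, L (b i) = 0 := fun i => sub_eq_zero.2 (congrFun h i)
  exact sub_eq_zero.1 (map_eq_zero_of_forall_orthonormalBasis b hL he)

variable [FiniteDimensional ℝ ES] [IsManifold IS ∞ S] [CompleteSpace F]

include EG in
variable (EG) in
theorem contMDiff_orbitCoordinates (e : ι → Lp ℝ 2 μ) (hf : ContMDiff IS 𝓘(ℝ, F) ∞ f) :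
    ContMDiff IS 𝓘(ℝ, ι → F) ∞ (orbitCoordinates e f) :=
  contMDiff_pi_space.2 fun _ => contMDiff_orbitIntegral EG (integrable_coe_Lp_two μ _) hf

include EG in
variable (EG) in
theorem ker_differential_orbitCoordinates (hf : ContMDiff IS 𝓘(ℝ, F) ∞ f) (x : S) :
    (differential IS (orbitCoordinates (fun i => (b i : Lp ℝ 2 μ)) f) x).ker
      = orbitKernel IS V f x := by
  have hdiff := (contMDiff_orbitCoordinates EG (fun i => (b i : Lp ℝ 2 μ)) hf).mdifferentiable
    (by simp) x
  ext v
  rw [LinearMap.mem_ker, mem_orbitKernel]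
  refine ⟨fun h e he => ?_, fun h => funext fun i => ?_⟩
  · rw [differential_orbitIntegral (EG := EG) hf]
    refine map_eq_zero_of_forall_orthonormalBasis b (fun i => ?_) he
    rw [← differential_orbitIntegral]
    exact (differential_pi_apply hdiff v i).symm.trans (congrFun h i)
  · exact (differential_pi_apply hdiff v i).trans (h _ (b i).2)

end Basis

variable [FiniteDimensional ℝ ES] [IsManifold IS ∞ S] [CompleteSpace F]
  [IsProbabilityMeasure μ] [T2Space G] [IsTopologicalGroup G] [μ.IsMulLeftInvariant]
  [μ.IsOpenPosMeasure]

include EG in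
variable (EG μ) in
theorem exists_isFiniteInvariant_eventually_orbitSeparates (hf : ContMDiff IS 𝓘(ℝ, F) ∞ f) {x y : S}
    (hxy : f x ≠ f y) :
    ∃ V, IsFiniteInvariant μ V ∧ ∀ᶠ p in 𝓝 (x, y), OrbitSeparates V f p.1 p.2 := by
  have hD : orbitMap EG G hf x - orbitMap EG G hf y ≠ 0 := fun h0 => by
    have h1 : f ((1 : G)⁻¹ • x) - f ((1 : G)⁻¹ • y) = 0 := DFunLike.congr_fun h0 1
    simp only [inv_one, one_smul] at h1
    exact hxy (sub_eq_zero.1 h1)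
  obtain ⟨V, hV, e, he, hne⟩ := exists_isFiniteInvariant_weightedIntegral_ne_zero μ hD
  rw [weightedIntegral_sub] at hne
  have hne' : orbitIntegral μ e f x ≠ orbitIntegral μ e f y := sub_ne_zero.1 hne
  have hcont := (contMDiff_orbitIntegral EG (integrable_coe_Lp_two μ e) hf).continuous
  refine ⟨V, hV, ?_⟩
  filter_upwards [((hcont.comp continuous_fst).continuousAt.ne_iff_eventually_ne
    (hcont.comp continuous_snd).continuousAt).1 hne'] with p hp h
  exact absurd (h e he) hp

include EG in
variable (EG μ) in
/-- Enlarging `V` decreases `orbitKernel`, and by the Peter–Weyl theorem every nonzero vector can be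
removed from it. -/
theorem exists_isFiniteInvariant_orbitKernel_eq_bot (hf : ContMDiff IS 𝓘(ℝ, F) ∞ f) {x : S}
    (hinj : Function.Injective (differential IS f x)) :
    ∃ V, IsFiniteInvariant μ V ∧ orbitKernel IS V f x = ⊥ := by
  obtain ⟨_, ⟨V, hV, rfl⟩, hmin⟩ := IsArtinian.set_has_minimal
    ((fun V => orbitKernel IS V f x) '' {V | IsFiniteInvariant μ V})
    ⟨_, ⊥, isFiniteInvariant_bot, rfl⟩
  refine ⟨V, hV, (Submodule.eq_bot_iff _).2 fun v hv => ?_⟩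
  by_contra hne
  have hD : orbitDifferential EG G hf x v ≠ 0 := fun h0 => by
    have h1 : differential IS (fun y => f ((1 : G)⁻¹ • y)) x v = 0 := DFunLike.congr_fun h0 1
    simp only [inv_one, one_smul] at h1
    exact hne ((injective_iff_map_eq_zero _).1 hinj v h1)
  obtain ⟨V', hV', e, he, hne'⟩ := exists_isFiniteInvariant_weightedIntegral_ne_zero μ hD
  refine hmin _ ⟨V ⊔ V', hV.sup hV', rfl⟩
    ((orbitKernel_anti le_sup_left x).lt_of_not_ge fun hle => hne' ?_)
  rw [← differential_orbitIntegral]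
  exact mem_orbitKernel.1 (hle hv) e (Submodule.mem_sup_right he)

variable [FiniteDimensional ℝ F]

include EG in
variable (EG μ) in
theorem exists_isFiniteInvariant_eventually_orbitKernel_eq_bot (hf : ContMDiff IS 𝓘(ℝ, F) ∞ f)
    {x : S} (hinj : Function.Injective (differential IS f x)) :
    ∃ V, IsFiniteInvariant μ V ∧ (∀ᶠ y in 𝓝 x, orbitKernel IS V f y = ⊥) ∧
      ∀ᶠ p in 𝓝 (x, x), OrbitSeparates V f p.1 p.2 := by
  obtain ⟨V, hV, hbot⟩ := exists_isFiniteInvariant_orbitKernel_eq_bot EG μ hf hinj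
  have := hV.finiteDimensional
  let b := stdOrthonormalBasis ℝ V
  have hsmooth := contMDiff_orbitCoordinates EG (fun i => (b i : Lp ℝ 2 μ)) hf
  have hw : Function.Injective
      (differential IS (orbitCoordinates (fun i => (b i : Lp ℝ 2 μ)) f) x) :=
    LinearMap.ker_eq_bot.1 ((ker_differential_orbitCoordinates EG b hf x).trans hbot)
  refine ⟨V, hV, ?_, ?_⟩
  · filter_upwards [eventually_injective_differential hsmooth hw] with y hy
    rw [← ker_differential_orbitCoordinates EG b hf]
    exact LinearMap.ker_eq_bot.2 hy
  · obtain ⟨U, hU, hinjOn⟩ := exists_nhds_injOn_of_injective_differential hsmooth hw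
    filter_upwards [prod_mem_nhds hU hU] with p hp
    exact (orbitSeparates_iff_orbitCoordinates EG b hf).2 (hinjOn hp.1 hp.2)

include EG in
variable (EG μ) in
theorem exists_isFiniteInvariant_orbitKernel_eq_bot_and_orbitSeparates
    (hf : ContMDiff IS 𝓘(ℝ, F) ∞ f) (hinj : Function.Injective f)
    (himm : ∀ x, Function.Injective (differential IS f x)) {K : Set S} (hK : IsCompact K) :
    ∃ V, IsFiniteInvariant μ V ∧ (∀ x ∈ K, orbitKernel IS V f x = ⊥) ∧
      ∀ x ∈ K, ∀ y ∈ K, OrbitSeparates V f x y := by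
  have hmono : ∀ {V V' : Submodule ℝ (Lp ℝ 2 μ)} {x : S}, V ≤ V' → orbitKernel IS V f x = ⊥ →
      orbitKernel IS V' f x = ⊥ :=
    fun hV h => le_bot_iff.1 ((orbitKernel_anti hV _).trans h.le)
  obtain ⟨V, hV, hVK⟩ := IsFiniteInvariant.exists_forall_mem_of_isCompact μ
    (p := fun V x => orbitKernel IS V f x = ⊥) (fun _ _ _ => hmono) hK fun x _ => by
      obtain ⟨V, hV, hx, -⟩ :=
        exists_isFiniteInvariant_eventually_orbitKernel_eq_bot EG μ hf (himm x)
      exact ⟨V, hV, hx⟩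
  obtain ⟨V', hV', hVK'⟩ := IsFiniteInvariant.exists_forall_mem_of_isCompact μ
    (p := fun V (p : S × S) => OrbitSeparates V f p.1 p.2) (fun _ _ _ h h' => h'.mono h)
    (hK.prod hK) fun p _ => by
      obtain ⟨x, y⟩ := p
      rcases eq_or_ne x y with rfl | hxy
      · obtain ⟨V, hV, -, hx⟩ :=
          exists_isFiniteInvariant_eventually_orbitKernel_eq_bot EG μ hf (himm x)
        exact ⟨V, hV, hx⟩
      · exact exists_isFiniteInvariant_eventually_orbitSeparates EG μ hf (hinj.ne hxy)
  exact ⟨V ⊔ V', hV.sup hV', fun x hx => hmono le_sup_left (hVK x hx),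
    fun x hx y hy => (hVK' (x, y) ⟨hx, hy⟩).mono le_sup_right⟩

end OrbitCoordinates

section OrbitCoordinatesEquivariance

open MeasureTheory

theorem orbitIntegral_of_invariant {G : Type*} [Group G] [MeasurableSpace G] (μ : Measure G)
    {S : Type*} [MulAction G S] {F : Type*} [NormedAddCommGroup F] [NormedSpace ℝ F]
    [CompleteSpace F] {f : S → F} (hf : ∀ (g : G) x, f (g • x) = f x) (c : G → ℝ) (x : S) :
    orbitIntegral μ c f x = (∫ g, c g ∂μ) • f x := by
  simp only [orbitIntegral, hf]
  exact integral_smul_const c (f x)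

variable {EG : Type*} [NormedAddCommGroup EG] [NormedSpace ℝ EG]
  {G : Type*} [Group G] [TopologicalSpace G] [ChartedSpace EG G] [LieGroup 𝓘(ℝ, EG) ∞ G]
  [CompactSpace G] [SecondCountableTopology G] [MeasurableSpace G] [BorelSpace G]
  {μ : Measure G}
  {ES : Type*} [NormedAddCommGroup ES] [NormedSpace ℝ ES]
  {HS : Type*} [TopologicalSpace HS] {IS : ModelWithCorners ℝ ES HS}
  {S : Type*} [TopologicalSpace S] [ChartedSpace HS S] [MulAction G S]
  [ContMDiffSMul 𝓘(ℝ, EG) IS ∞ G S]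
  {F : Type*} [NormedAddCommGroup F] [NormedSpace ℝ F]
  {F' : Type*} [NormedAddCommGroup F'] [NormedSpace ℝ F']

include EG in
variable (EG) in
theorem orbitIntegral_prodMk [CompleteSpace F] [CompleteSpace F'] {f : S → F} {f' : S → F'}
    (hf : ContMDiff IS 𝓘(ℝ, F) ∞ f) (hf' : ContMDiff IS 𝓘(ℝ, F') ∞ f') {c : G → ℝ}
    (hc : Integrable c μ) (x : S) :
    orbitIntegral μ c (fun y => (f y, f' y)) x = (orbitIntegral μ c f x, orbitIntegral μ c f' x) :=
  integral_pair (integrable_smul_of_continuous hc (orbitMap EG G hf x).continuous)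
    (integrable_smul_of_continuous hc (orbitMap EG G hf' x).continuous)

variable [IsTopologicalGroup G] [IsFiniteMeasure μ] [μ.IsMulLeftInvariant]
  {V : Submodule ℝ (Lp ℝ 2 μ)} {ι : Type*} [Fintype ι]

include EG in
variable (EG) in
theorem orbitCoordinates_smul (hV : IsFiniteInvariant μ V) (b : OrthonormalBasis ι ℝ V) {f : S → F}
    (hf : ContMDiff IS 𝓘(ℝ, F) ∞ f) (g : G) (x : S) (i : ι) :
    orbitCoordinates (fun i => (b i : Lp ℝ 2 μ)) f (g • x) i
      = ∑ j, matrixCoefficients (leftRegular μ) b g i j •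
          orbitCoordinates (fun i => (b i : Lp ℝ 2 μ)) f x j := by
  have horbit : orbitMap EG G hf (g • x)
      = (orbitMap EG G hf x).comp (ContinuousMap.mulLeft g⁻¹) := by
    ext h
    change f (h⁻¹ • g • x) = f ((g⁻¹ * h)⁻¹ • x)
    rw [smul_smul, mul_inv_rev, inv_inv]
  have hcoeff : ∀ j, matrixCoefficients (leftRegular μ) b g⁻¹ j i
      = matrixCoefficients (leftRegular μ) b g i j := fun j =>
    ((inner_map_eq_inner_inv_map (leftRegular μ) g _ _).trans (real_inner_comm _ _)).symm
  change weightedIntegral μ (orbitMap EG G hf (g • x)) (b i) = _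
  rw [horbit, ← weightedIntegral_leftRegular, map_orthonormalBasis_eq_sum hV.map_mem, map_sum]
  exact Finset.sum_congr rfl fun j _ => by
    rw [map_smul, hcoeff]
    rfl

end OrbitCoordinatesEquivariance

namespace SmoothCone

open MeasureTheory

variable {ES : Type*} [NormedAddCommGroup ES] [NormedSpace ℝ ES]
  {HS : Type*} [TopologicalSpace HS] {IS : ModelWithCorners ℝ ES HS}
  {EX : Type*} [NormedAddCommGroup EX] [NormedSpace ℝ EX]
  {HX : Type*} [TopologicalSpace HX] {IX : ModelWithCorners ℝ EX HX}
  {S : Type*} [TopologicalSpace S] [ChartedSpace HS S]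
  {X : Type*} [TopologicalSpace X] [ChartedSpace HX X] {C : SmoothCone IS IX S X} {r : S → ℝ}
  {F : Type*}

theorem IsRadius.injective_prodMk_of_injOn (hr : C.IsRadius r) {w : S → F} (hw : C.IsDegreeZero w)
    (hinj : InjOn w {x | r x = 1}) : Function.Injective fun x => (r x, w x) := fun x y hxy => by
  obtain ⟨hrxy, hwxy⟩ := Prod.ext_iff.1 hxy
  have hpos := inv_pos.2 (hr.pos y)
  have hdil : C.dil (r x)⁻¹ x = C.dil (r y)⁻¹ y := hinj (hr.map_dil_inv x) (hr.map_dil_inv y) <|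
    (hw _ (inv_pos.2 (hr.pos x)) x).trans (hwxy.trans (hw _ hpos y).symm)
  rw [show r x = r y from hrxy] at hdil
  rw [← C.dil_inv_dil hpos x, hdil, C.dil_inv_dil hpos]

theorem injective_mfderiv_dil (C : SmoothCone IS IX S X) {t : ℝ} (ht : 0 < t) (x : S) :
    Function.Injective (mfderiv IS IS (C.dil t) x) := by
  have hcomp := mfderiv_comp x ((C.contMDiff_dil (inv_pos.2 ht)).mdifferentiable (by simp) _)
    ((C.contMDiff_dil ht).mdifferentiable (by simp) x)
  rw [show C.dil t⁻¹ ∘ C.dil t = id from funext fun y => C.dil_inv_dil ht y, mfderiv_id] at hcomp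
  exact Function.LeftInverse.injective (g := mfderiv IS IS (C.dil t⁻¹) (C.dil t x))
    fun v => (DFunLike.congr_fun hcomp v).symm

theorem IsRadius.injective_differential_prodMk [NormedAddCommGroup F] [NormedSpace ℝ F]
    (hr : C.IsRadius r) {w : S → F} (hw : C.IsDegreeZero w) (hws : ContMDiff IS 𝓘(ℝ, F) ∞ w)
    (hinj : ∀ x, r x = 1 → Function.Injective (differential IS (fun x => (r x, w x)) x)) (x : S) :
    Function.Injective (differential IS (fun x => (r x, w x)) x) := by
  have hpos := inv_pos.2 (hr.pos x)
  have hdiff : MDifferentiable IS 𝓘(ℝ, ℝ × F) fun x => (r x, w x) :=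
    (hr.contMDiff.prodMk_space hws).mdifferentiable (by simp)
  let L : ℝ × F →L[ℝ] ℝ × F := ((r x)⁻¹ • ContinuousLinearMap.id ℝ ℝ).prodMap (.id ℝ F)
  have hL : (fun y => (r (C.dil (r x)⁻¹ y), w (C.dil (r x)⁻¹ y))) = fun y => L (r y, w y) :=
    funext fun y => Prod.ext (hr.map_dil _ hpos y) (hw _ hpos y)
  have hcomp : ∀ v : ES, differential IS (fun x => (r x, w x)) (C.dil (r x)⁻¹ x)
      (mfderiv IS IS (C.dil (r x)⁻¹) x v) = L (differential IS (fun x => (r x, w x)) x v) :=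
    fun v => by
      rw [← differential_comp_self_map (hdiff _)
        ((C.contMDiff_dil hpos).mdifferentiable (by simp) x), ← differential_clm_comp (hdiff x), hL]
  refine fun v v' hv => C.injective_mfderiv_dil hpos x (hinj _ (hr.map_dil_inv x) ?_)
  exact (hcomp v).trans ((congrArg L hv).trans (hcomp v').symm)

theorem IsDegreeZero.orbitIntegral {G : Type*} [Group G] [MulAction G S] [MeasurableSpace G]
    [NormedAddCommGroup F] [NormedSpace ℝ F] {f : S → F} (hf : C.IsDegreeZero f)
    (hcomm : ∀ (g : G) (t : ℝ), 0 < t → ∀ x : S, g • C.dil t x = C.dil t (g • x))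
    (μ : Measure G) (c : G → ℝ) : C.IsDegreeZero (orbitIntegral μ c f) := fun t ht x => by
  simp only [_root_.orbitIntegral, hcomm _ t ht, hf t ht]

section EquivariantImmersion

variable {EG : Type*} [NormedAddCommGroup EG] [NormedSpace ℝ EG]
  {G : Type*} [Group G] [TopologicalSpace G] [ChartedSpace EG G] [LieGroup 𝓘(ℝ, EG) ∞ G]
  [CompactSpace G] [T2Space G] [SecondCountableTopology G] [IsTopologicalGroup G]
  [MeasurableSpace G] [BorelSpace G] (μ : Measure G) [IsProbabilityMeasure μ]
  [μ.IsMulLeftInvariant] [μ.IsOpenPosMeasure]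
  [MulAction G S] [ContMDiffSMul 𝓘(ℝ, EG) IS ∞ G S]
  [FiniteDimensional ℝ ES] [IsManifold IS ∞ S]

include EG in
variable (EG) in
/-- On the compact level set `r = 1` finitely many weights suffice, and homogeneity extends the
conclusion to the whole cone. -/
theorem IsRadius.exists_isFiniteInvariant_injective_immersion [NormedAddCommGroup F]
    [NormedSpace ℝ F] [FiniteDimensional ℝ F] [CompactSpace X] [T2Space X] (hr : C.IsRadius r)
    (hrG : ∀ (g : G) x, r (g • x) = r x)
    (hcomm : ∀ (g : G) (t : ℝ), 0 < t → ∀ x : S, g • C.dil t x = C.dil t (g • x)) {f : S → F}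
    (hf : ContMDiff IS 𝓘(ℝ, F) ∞ f) (hf0 : C.IsDegreeZero f)
    (hinj : Function.Injective fun x => (r x, f x))
    (himm : ∀ x, Function.Injective (differential IS (fun x => (r x, f x)) x)) :
    ∃ V, IsFiniteInvariant μ V ∧
      ∀ {ι : Type} [Fintype ι] (b : OrthonormalBasis ι ℝ V),
        (Function.Injective fun x => (r x, orbitCoordinates (fun i => (b i : Lp ℝ 2 μ)) f x)) ∧
        ∀ x, Function.Injective (differential IS
          (fun x => (r x, orbitCoordinates (fun i => (b i : Lp ℝ 2 μ)) f x)) x) := by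
  obtain ⟨V, hV, hker, hsep⟩ := exists_isFiniteInvariant_orbitKernel_eq_bot_and_orbitSeparates EG μ
    (hr.contMDiff.prodMk_space hf) hinj himm hr.isCompact_setOf_eq_one
  refine ⟨V, hV, fun {ι} _ b => ?_⟩
  let w := orbitCoordinates (fun i => (b i : Lp ℝ 2 μ)) f
  have hw : ContMDiff IS 𝓘(ℝ, ι → F) ∞ w := contMDiff_orbitCoordinates EG _ hf
  have hw0 : C.IsDegreeZero w := fun t ht x =>
    funext fun i => hf0.orbitIntegral hcomm μ (b i) t ht x
  let L : ℝ × (ι → F) →L[ℝ] ι → ℝ × F := .pi fun i =>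
    ((∫ g, (b i : Lp ℝ 2 μ) g ∂μ) • ContinuousLinearMap.id ℝ ℝ).prodMap (.proj i)
  have hL : orbitCoordinates (fun i => (b i : Lp ℝ 2 μ)) (fun x => (r x, f x))
      = fun x => L (r x, w x) := funext fun x => funext fun i => by
    rw [orbitCoordinates, orbitIntegral_prodMk EG hr.contMDiff hf (integrable_coe_Lp_two μ _),
      orbitIntegral_of_invariant μ hrG]
    rfl
  constructor
  · refine hr.injective_prodMk_of_injOn hw0 fun x hx y hy hxy => ?_
    refine (orbitSeparates_iff_orbitCoordinates EG b (hr.contMDiff.prodMk_space hf)).1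
      (hsep x hx y hy) ?_
    rw [hL]
    exact congrArg L (Prod.ext (hx.trans (Eq.symm hy)) hxy)
  · refine hr.injective_differential_prodMk hw0 hw fun x hx => ?_
    have hinjL := LinearMap.ker_eq_bot.1 ((ker_differential_orbitCoordinates EG b
      (hr.contMDiff.prodMk_space hf) x).trans (hker x hx))
    rw [hL] at hinjL
    exact injective_differential_of_clm_comp
      ((hr.contMDiff.prodMk_space hw).mdifferentiable (by simp) x) L hinjL

include EG μ in
variable (EG) in
theorem IsRadius.exists_equivariant_injective_immersion [CompactSpace X] [T2Space X]
    [FiniteDimensional ℝ EX] [IsManifold IX ∞ X] (hr : C.IsRadius r)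
    (hrG : ∀ (g : G) x, r (g • x) = r x)
    (hcomm : ∀ (g : G) (t : ℝ), 0 < t → ∀ x : S, g • C.dil t x = C.dil t (g • x)) :
    ∃ (d N : ℕ) (M : G → Matrix (Fin d × Fin N) (Fin d × Fin N) ℝ) (w : S → Fin d × Fin N → ℝ),
      IsOrthogonalMatrixRep M ∧ ContMDiff IS 𝓘(ℝ, Fin d × Fin N → ℝ) ∞ w ∧
      (∀ g x, w (g • x) = (M g).mulVec (w x)) ∧ C.IsDegreeZero w ∧
      (Function.Injective fun x => (r x, w x)) ∧
      ∀ x, Function.Injective (differential IS (fun x => (r x, w x)) x) := by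
  obtain ⟨N, f, hf, hf0, hinj, himm⟩ := hr.exists_isDegreeZero_injective_immersion
  obtain ⟨V, hV, hVinj⟩ := hr.exists_isFiniteInvariant_injective_immersion EG μ hrG hcomm hf hf0
    hinj himm
  have := hV.finiteDimensional
  let d := Module.finrank ℝ V
  let b : OrthonormalBasis (Fin d) ℝ V := stdOrthonormalBasis ℝ V
  obtain ⟨hbinj, hbimm⟩ := hVinj b
  let v := orbitCoordinates (fun i => (b i : Lp ℝ 2 μ)) f
  have hv : ∀ i k, ContMDiff IS 𝓘(ℝ, ℝ) ∞ fun x => v x i k := fun i k =>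
    (EuclideanSpace.proj (𝕜 := ℝ) k).contMDiff.comp
      (contMDiff_orbitIntegral EG (integrable_coe_Lp_two μ (b i)) hf)
  have hw : ContMDiff IS 𝓘(ℝ, Fin d × Fin N → ℝ) ∞ fun x (p : Fin d × Fin N) => v x p.1 p.2 :=
    contMDiff_pi_space.2 fun p => hv p.1 p.2
  let L : ℝ × (Fin d × Fin N → ℝ) →L[ℝ] ℝ × (Fin d → EuclideanSpace ℝ (Fin N)) :=
    (ContinuousLinearMap.id ℝ ℝ).prodMap <| .pi fun i =>
      (EuclideanSpace.equiv (Fin N) ℝ).symm.toContinuousLinearMap ∘L .pi fun k => .proj (i, k)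
  refine ⟨_, N, _, fun x p => v x p.1 p.2,
    (isOrthogonalMatrixRep_matrixCoefficients hV.map_mem b
    (continuous_leftRegular μ)).blockDiagonal (Fin N), hw, fun g x => funext fun p => ?_,
    fun t ht x => funext fun p => ?_, .of_comp (f := L) hbinj, fun x =>
    injective_differential_of_clm_comp ((hr.contMDiff.prodMk_space hw).mdifferentiable (by simp) x)
      L (hbimm x)⟩
  · change v (g • x) p.1 p.2 = _
    rw [Matrix.mulVec, dotProduct, Fintype.sum_prod_type]
    simp only [Matrix.blockDiagonal_apply, ite_mul, zero_mul, Finset.sum_ite_eq, Finset.mem_univ,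
      if_true]
    rw [show v (g • x) p.1 = _ from orbitCoordinates_smul EG hV b hf g x p.1, WithLp.ofLp_sum,
      Finset.sum_apply]
    rfl
  · exact congrArg (fun u : EuclideanSpace ℝ (Fin N) => u p.2)
      (hf0.orbitIntegral hcomm μ (b p.1) t ht x)

end EquivariantImmersion

end SmoothCone

namespace SmoothCone

variable {ES : Type*} [NormedAddCommGroup ES] [NormedSpace ℝ ES]
  {HS : Type*} [TopologicalSpace HS] {IS : ModelWithCorners ℝ ES HS}
  {EX : Type*} [NormedAddCommGroup EX] [NormedSpace ℝ EX]
  {HX : Type*} [TopologicalSpace HX] {IX : ModelWithCorners ℝ EX HX}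
  {S : Type*} [TopologicalSpace S] [ChartedSpace HS S] [IsManifold IS ∞ S]
  {X : Type*} [TopologicalSpace X] [ChartedSpace HX X] {C : SmoothCone IS IX S X} {r : S → ℝ}
  {F : Type*} [NormedAddCommGroup F] [NormedSpace ℝ F] {w : S → F} {lam : SmoothOneForm IS S}

section Coefficients

variable [FiniteDimensional ℝ ES] [FiniteDimensional ℝ F] [T2Space S] [SigmaCompactSpace S]

/-- The differential of the radius does not contribute, since on the radial field it takes the value
`r ≠ 0` while `lam` and `dw` vanish there. -/
theorem IsRadius.exists_eq_comp_differential (hr : C.IsRadius r) (hw : ContMDiff IS 𝓘(ℝ, F) ∞ w)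
    (hw0 : C.IsDegreeZero w)
    (himm : ∀ x, Function.Injective (differential IS (fun x => (r x, w x)) x))
    (hhor : C.IsHorizontal lam) :
    ∃ b : S → F →L[ℝ] ℝ, ContMDiff IS 𝓘(ℝ, F →L[ℝ] ℝ) ∞ b ∧
      ∀ x (v : ES), lam x v = b x (differential IS w x v) := by
  obtain ⟨L, hL, hLlam⟩ :=
    exists_oneForm_eq_comp_differential (hr.contMDiff.prodMk_space hw) himm lam
  have hsplit (x : S) (v : ES) : lam x v
      = differential IS r x v * L x (1, 0) + L x (0, differential IS w x v) := by
    have hdecomp : differential IS (fun x => (r x, w x)) x v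
        = differential IS r x v • ((1 : ℝ), (0 : F)) + (0, differential IS w x v) := by
      rw [differential_prodMk (hr.contMDiff.mdifferentiable (by simp) x)
        (hw.mdifferentiable (by simp) x)]
      simp
    rw [← hLlam, hdecomp, map_add, map_smul, smul_eq_mul]
  have hzero (x : S) : L x (1, 0) = 0 := by
    have h := (hsplit x (C.radialField x)).symm.trans (hhor x)
    rw [hr.differential_radialField, hw0.differential_radialField (hw.mdifferentiable (by simp) x),
      Prod.mk_zero_zero, map_zero, add_zero] at h
    exact (mul_eq_zero.1 h).resolve_left (hr.pos x).ne'
  refine ⟨fun x => L x ∘L .inr ℝ ℝ F, ?_, fun x v => ?_⟩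
  · exact ((ContinuousLinearMap.compL ℝ F (ℝ × F) ℝ).flip (.inr ℝ ℝ F)).contMDiff.comp hL
  · rw [hsplit, hzero, mul_zero, zero_add]
    rfl

theorem IsRadius.exists_eq_mul_isDegreeZero_comp_differential (hr : C.IsRadius r)
    (hw : ContMDiff IS 𝓘(ℝ, F) ∞ w) (hw0 : C.IsDegreeZero w)
    (himm : ∀ x, Function.Injective (differential IS (fun x => (r x, w x)) x))
    (hhor : C.IsHorizontal lam) (hhom : C.HasRadialLieDeriv lam lam) :
    ∃ b : S → F →L[ℝ] ℝ, ContMDiff IS 𝓘(ℝ, F →L[ℝ] ℝ) ∞ b ∧ C.IsDegreeZero b ∧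
      ∀ x (v : ES), lam x v = r x * b x (differential IS w x v) := by
  obtain ⟨b, hb, hblam⟩ := hr.exists_eq_comp_differential hw hw0 himm hhor
  refine ⟨fun x => b (C.dil (r x)⁻¹ x), hb.comp hr.contMDiff_dil_inv,
    fun t ht x => congrArg b (hr.isDegreeZero_dil_inv t ht x), fun x v => ?_⟩
  have hpos := inv_pos.2 (hr.pos x)
  have hdw : differential IS w x v = differential IS w (C.dil (r x)⁻¹ x)
      (mfderiv IS IS (C.dil (r x)⁻¹) x v) := by
    rw [← differential_comp_self_map (hw.mdifferentiable (by simp) _)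
      ((C.contMDiff_dil hpos).mdifferentiable (by simp) x)]
    simp only [hw0 _ hpos]
  have hpull := (hblam _ _).symm.trans (pullbackOneForm_dil hhom hpos x v)
  rw [hdw, hpull, mul_inv_cancel_left₀ (hr.pos x).ne']

end Coefficients

end SmoothCone

theorem clm_apply_eq_dotProduct {ι : Type*} [Fintype ι] [DecidableEq ι] (L : (ι → ℝ) →L[ℝ] ℝ)
    (u : ι → ℝ) : L u = (fun i => L (Pi.single i 1)) ⬝ᵥ u := by
  conv_lhs => rw [pi_eq_sum_univ' u, map_sum]
  simp only [map_smul, smul_eq_mul, dotProduct, mul_comm]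

section EquivariantAverage

open MeasureTheory

variable {G : Type*} [Group G] [MeasurableSpace G] (μ : Measure G)
  {S : Type*} [MulAction G S] {ι : Type*} [Fintype ι] {M : G → Matrix ι ι ℝ} {b : S → ι → ℝ}

/-- The average of a vector-valued function over a group acting on both the source and, by
matrices, the target. -/
noncomputable def equivariantAverage (M : G → Matrix ι ι ℝ) (b : S → ι → ℝ) (x : S) : ι → ℝ :=
  ∫ g, (M g).mulVec (b (g⁻¹ • x)) ∂μ

variable {μ}

theorem equivariantAverage_apply
    (hint : ∀ i j x, Integrable (fun g => M g i j * b (g⁻¹ • x) j) μ) (x : S) (i : ι) :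
    equivariantAverage μ M b x i
      = ∑ j, orbitIntegral μ (fun g => M g i j) (fun y => b y j) x :=
  (eval_integral (fun k => integrable_finsetSum _ fun j _ => hint k j x) i).trans
    (integral_finsetSum _ fun j _ => hint i j x)

theorem equivariantAverage_smul [MeasurableMul G] [μ.IsMulLeftInvariant]
    (hM : ∀ g h, M (g * h) = M g * M h)
    (hint : ∀ x, Integrable (fun g => (M g).mulVec (b (g⁻¹ • x))) μ) (h : G) (x : S) :
    equivariantAverage μ M b (h • x) = (M h).mulVec (equivariantAverage μ M b x) := by
  refine Eq.trans ?_ (((M h).mulVecLin.toContinuousLinearMap).integral_comp_comm (hint x))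
  rw [equivariantAverage, ← integral_mul_left_eq_self _ h]
  refine integral_congr_ae (.of_forall fun g => ?_)
  simp only [hM, mul_inv_rev, mul_smul, inv_smul_smul, ← Matrix.mulVec_mulVec]
  rfl

theorem equivariantAverage_dotProduct [IsProbabilityMeasure μ] {x : S}
    (hint : Integrable (fun g => (M g).mulVec (b (g⁻¹ • x))) μ) {u : ι → ℝ} {c : ℝ}
    (h : ∀ g, (M g).mulVec (b (g⁻¹ • x)) ⬝ᵥ u = c) : equivariantAverage μ M b x ⬝ᵥ u = c := by
  let L : (ι → ℝ) →L[ℝ] ℝ := (dotProductBilin ℝ ℝ u).toContinuousLinearMap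
  have hL (y : ι → ℝ) : L y = y ⬝ᵥ u := dotProduct_comm u y
  rw [equivariantAverage, ← hL, ← L.integral_comp_comm hint]
  simp only [hL, h, integral_const, probReal_univ, one_smul]

end EquivariantAverage

section AveragedCoefficients

open MeasureTheory

variable {EG : Type*} [NormedAddCommGroup EG] [NormedSpace ℝ EG]
  {G : Type*} [Group G] [TopologicalSpace G] [ChartedSpace EG G] [LieGroup 𝓘(ℝ, EG) ∞ G]
  [CompactSpace G] [MeasurableSpace G] [BorelSpace G] {μ : Measure G} [IsFiniteMeasure μ]
  {ES : Type*} [NormedAddCommGroup ES] [NormedSpace ℝ ES]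
  {HS : Type*} [TopologicalSpace HS] {IS : ModelWithCorners ℝ ES HS}
  {S : Type*} [TopologicalSpace S] [ChartedSpace HS S]
  [MulAction G S] [ContMDiffSMul 𝓘(ℝ, EG) IS ∞ G S]
  {ι : Type*} [Fintype ι] {M : G → Matrix ι ι ℝ} {b : S → ι → ℝ}

include EG in
variable (EG) in
theorem integrable_mulVec_inv_smul (hM : Continuous M) (hb : ContMDiff IS 𝓘(ℝ, ι → ℝ) ∞ b) (x : S) :
    Integrable (fun g => (M g).mulVec (b (g⁻¹ • x))) μ :=
  (hM.matrix_mulVec (orbitMap EG G hb x).continuous).integrable_of_hasCompactSupport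
    (.of_compactSpace _)

include EG in
variable (EG) in
theorem contMDiff_equivariantAverage [SecondCountableTopology G] [FiniteDimensional ℝ ES]
    [IsManifold IS ∞ S] (hM : Continuous M) (hb : ContMDiff IS 𝓘(ℝ, ι → ℝ) ∞ b) :
    ContMDiff IS 𝓘(ℝ, ι → ℝ) ∞ (equivariantAverage μ M b) := by
  have hMint (i j : ι) : Integrable (fun g => M g i j) μ :=
    (hM.matrix_elem i j).integrable_of_hasCompactSupport (.of_compactSpace _)
  have hbj (j : ι) := contMDiff_pi_space.1 hb j
  refine contMDiff_pi_space.2 fun i => ?_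
  simp only [equivariantAverage_apply fun i j x =>
    integrable_smul_of_continuous (hMint i j) (orbitMap EG G (hbj j) x).continuous]
  exact contMDiff_finsetSum fun j _ => contMDiff_orbitIntegral EG (hMint i j) (hbj j)

end AveragedCoefficients

namespace SmoothCone

open MeasureTheory

variable {EG : Type*} [NormedAddCommGroup EG] [NormedSpace ℝ EG]
  {G : Type*} [Group G] [TopologicalSpace G] [ChartedSpace EG G] [LieGroup 𝓘(ℝ, EG) ∞ G]
  [CompactSpace G] [SecondCountableTopology G] [IsTopologicalGroup G]
  [MeasurableSpace G] [BorelSpace G] (μ : Measure G) [IsProbabilityMeasure μ]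
  [μ.IsMulLeftInvariant]
  {ES : Type*} [NormedAddCommGroup ES] [NormedSpace ℝ ES] [FiniteDimensional ℝ ES]
  {HS : Type*} [TopologicalSpace HS] {IS : ModelWithCorners ℝ ES HS}
  {EX : Type*} [NormedAddCommGroup EX] [NormedSpace ℝ EX]
  {HX : Type*} [TopologicalSpace HX] {IX : ModelWithCorners ℝ EX HX}
  {S : Type*} [TopologicalSpace S] [ChartedSpace HS S] [IsManifold IS ∞ S]
  {X : Type*} [TopologicalSpace X] [ChartedSpace HX X] {C : SmoothCone IS IX S X} {r : S → ℝ}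
  [MulAction G S] [ContMDiffSMul 𝓘(ℝ, EG) IS ∞ G S]
  {ι : Type*} [Fintype ι] [DecidableEq ι] {M : G → Matrix ι ι ℝ} {w : S → ι → ℝ}
  {lam : SmoothOneForm IS S}

include EG μ in
variable (EG) in
theorem IsRadius.exists_equivariant_coefficients [T2Space S] [SigmaCompactSpace S]
    (hr : C.IsRadius r) (hrG : ∀ (g : G) x, r (g • x) = r x)
    (hcomm : ∀ (g : G) (t : ℝ), 0 < t → ∀ x : S, g • C.dil t x = C.dil t (g • x))
    (hM : IsOrthogonalMatrixRep M) (hw : ContMDiff IS 𝓘(ℝ, ι → ℝ) ∞ w)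
    (hwM : ∀ g x, w (g • x) = (M g).mulVec (w x)) (hw0 : C.IsDegreeZero w)
    (himm : ∀ x, Function.Injective (differential IS (fun x => (r x, w x)) x))
    (hinv : ∀ (g : G) (x : S) (v : TangentSpace IS x),
      pullbackOneForm (fun y : S => g • y) lam x v = lam x v)
    (hhor : C.IsHorizontal lam) (hhom : C.HasRadialLieDeriv lam lam) :
    ∃ β : S → ι → ℝ, ContMDiff IS 𝓘(ℝ, ι → ℝ) ∞ β ∧
      (∀ g x, β (g • x) = (M g).mulVec (β x)) ∧ C.IsDegreeZero β ∧
      ∀ x (v : ES), lam x v = r x * (β x ⬝ᵥ differential IS w x v) := by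
  obtain ⟨L, hL, hL0, hLlam⟩ :=
    hr.exists_eq_mul_isDegreeZero_comp_differential hw hw0 himm hhor hhom
  let b (x : S) (i : ι) : ℝ := L x (Pi.single i 1)
  have hb : ContMDiff IS 𝓘(ℝ, ι → ℝ) ∞ b := contMDiff_pi_space.2 fun i =>
    (ContinuousLinearMap.apply ℝ ℝ (Pi.single i 1 : ι → ℝ)).contMDiff.comp hL
  have hint := integrable_mulVec_inv_smul (μ := μ) EG hM.continuous hb
  refine ⟨equivariantAverage μ M b, contMDiff_equivariantAverage EG hM.continuous hb,
    equivariantAverage_smul hM.map_mul hint, fun t ht x => ?_, fun x v => ?_⟩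
  · simp only [equivariantAverage, hcomm _ t ht, b, hL0 t ht]
  rw [equivariantAverage_dotProduct (hint x) (c := (r x)⁻¹ * lam x v) fun g => ?_,
    mul_inv_cancel_left₀ (hr.pos x).ne']
  have hsmul : MDifferentiableAt IS IS (fun y : S => g⁻¹ • y) x :=
    ((contMDiff_smul (I := 𝓘(ℝ, EG)) (I' := IS)).comp
      (contMDiff_const.prodMk contMDiff_id)).mdifferentiable (n := ∞) (by simp) x
  have hdw : differential IS w (g⁻¹ • x) (mfderiv IS IS (fun y : S => g⁻¹ • y) x v)
      = (M g⁻¹).mulVec (differential IS w x v) := by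
    rw [← differential_comp_self_map (hw.mdifferentiable (by simp) _) hsmul]
    simp only [hwM]
    exact differential_clm_comp (hw.mdifferentiable (by simp) x)
      (M g⁻¹).mulVecLin.toContinuousLinearMap v
  have hpull := (hLlam _ _).symm.trans (hinv g⁻¹ x v)
  rw [← hpull, hrG, inv_mul_cancel_left₀ (hr.pos x).ne', hdw, clm_apply_eq_dotProduct,
    Matrix.dotProduct_mulVec, ← hM.transpose, Matrix.vecMul_transpose]

end SmoothCone

section SmoothEmbedding

variable {ES : Type*} [NormedAddCommGroup ES] [NormedSpace ℝ ES]
  {HS : Type*} [TopologicalSpace HS] {IS : ModelWithCorners ℝ ES HS}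
  {S : Type*} [TopologicalSpace S] [ChartedSpace HS S]
  {F : Type*} [NormedAddCommGroup F] [NormedSpace ℝ F]
  {F' : Type*} [NormedAddCommGroup F'] [NormedSpace ℝ F']

theorem isSmoothEmbeddingInto_of_clm_comp {f : S → F} (hf : ContMDiff IS 𝓘(ℝ, F) ∞ f)
    (L : F →L[ℝ] F') (hL : IsSmoothEmbeddingInto IS fun x => L (f x)) :
    IsSmoothEmbeddingInto IS f :=
  have himm (x : S) : Function.Injective (differential IS f x) :=
    injective_differential_of_clm_comp (hf.mdifferentiable (by simp) x) L (hL.2.2 x)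
  ⟨hf, .of_comp hf.continuous L.continuous hL.2.1, himm⟩

namespace SmoothCone

variable {EX : Type*} [NormedAddCommGroup EX] [NormedSpace ℝ EX]
  {HX : Type*} [TopologicalSpace HX] {IX : ModelWithCorners ℝ EX HX}
  {X : Type*} [TopologicalSpace X] [ChartedSpace HX X]
  {C : SmoothCone IS IX S X} {r : S → ℝ}

theorem IsRadius.contMDiff_sqrt (hr : C.IsRadius r) : ContMDiff IS 𝓘(ℝ, ℝ) ∞ fun x => √(r x) :=
  fun x => (Real.contDiffAt_sqrt (hr.pos x).ne').contMDiffAt.comp x (hr.contMDiff x)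

variable [CompactSpace X] [T2Space X]

theorem IsRadius.isEmbedding_prodMk (hr : C.IsRadius r) {W : Type*} [TopologicalSpace W]
    [T2Space W] {w : S → W} (hw : Continuous w) (hw0 : C.IsDegreeZero w)
    (hinj : Function.Injective fun x => (r x, w x)) : IsEmbedding fun x => (r x, w x) := by
  have : CompactSpace {x | r x = 1} := isCompact_iff_compactSpace.1 hr.isCompact_setOf_eq_one
  have hlevel : IsEmbedding fun k : {x | r x = 1} => w k :=
    ((hw.comp continuous_subtype_val).isClosedEmbedding fun k k' h =>
      Subtype.ext (hinj (Prod.ext (k.2.trans k'.2.symm) h))).isEmbedding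
  let polar (x : S) : Ioi (0 : ℝ) × {x | r x = 1} :=
    (⟨r x, hr.pos x⟩, ⟨C.dil (r x)⁻¹ x, hr.map_dil_inv x⟩)
  have hpolar : IsEmbedding polar := by
    refine Function.LeftInverse.isEmbedding (f := fun q => C.dil q.1 q.2) (fun x => ?_) ?_
      ((hr.contMDiff.continuous.subtype_mk _).prodMk (hr.contMDiff_dil_inv.continuous.subtype_mk _))
    · change C.dil (r x) (C.dil (r x)⁻¹ x) = x
      rw [← C.dil_mul _ _ (hr.pos x) (inv_pos.2 (hr.pos x)), mul_inv_cancel₀ (hr.pos x).ne',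
        C.dil_one]
    · exact C.contMDiffOn_dil.continuousOn.comp_continuous
        (f := fun q : Ioi (0 : ℝ) × {x | r x = 1} => ((q.1 : ℝ), (q.2 : S))) (by fun_prop)
        fun q => ⟨q.1.2, mem_univ _⟩
  convert (IsEmbedding.subtypeVal.prodMap hlevel).comp hpolar using 1
  funext x
  exact Prod.ext rfl (hw0 _ (inv_pos.2 (hr.pos x)) x).symm

theorem IsRadius.isEmbedding_sqrt_smul (hr : C.IsRadius r) {w : S → F} (hw : Continuous w)
    (hw0 : C.IsDegreeZero w) (hinj : Function.Injective fun x => (r x, w x)) :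
    IsEmbedding fun x => (√(r x), √(r x) • w x) := by
  have hpos (x : S) : 0 < √(r x) := Real.sqrt_pos.2 (hr.pos x)
  let f (x : S) : Ioi (0 : ℝ) × F := (⟨√(r x), hpos x⟩, √(r x) • w x)
  let undo (p : Ioi (0 : ℝ) × F) : ℝ × F := ((p.1 : ℝ) ^ 2, (p.1 : ℝ)⁻¹ • p.2)
  have hs : Continuous fun x => √(r x) := hr.contMDiff_sqrt.continuous
  have hundo : Continuous undo := by
    refine .prodMk (by fun_prop) (.smul (.inv₀ (by fun_prop) fun p => p.1.2.ne') continuous_snd)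
  have hcomp : undo ∘ f = fun x => (r x, w x) := funext fun x =>
    Prod.ext (Real.sq_sqrt (hr.pos x).le) (inv_smul_smul₀ (hpos x).ne' _)
  exact (IsEmbedding.subtypeVal.prodMap .id).comp
    (.of_comp ((hs.subtype_mk _).prodMk (hs.smul hw)) hundo
      (hcomp ▸ hr.isEmbedding_prodMk hw hw0 hinj))

theorem IsRadius.isSmoothEmbeddingInto_sqrt_smul (hr : C.IsRadius r) {w : S → F}
    (hw : ContMDiff IS 𝓘(ℝ, F) ∞ w) (hw0 : C.IsDegreeZero w)
    (hinj : Function.Injective fun x => (r x, w x))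
    (himm : ∀ x, Function.Injective (differential IS (fun x => (r x, w x)) x)) :
    IsSmoothEmbeddingInto IS fun x => (√(r x), √(r x) • w x) := by
  refine ⟨hr.contMDiff_sqrt.prodMk_space (hr.contMDiff_sqrt.smul hw),
    hr.isEmbedding_sqrt_smul hw.continuous hw0 hinj, fun x => ?_⟩
  have hsx := hr.contMDiff_sqrt.mdifferentiable (by simp) x
  have hwx := hw.mdifferentiable (by simp) x
  have hswx : MDifferentiableAt IS 𝓘(ℝ, F) (fun y => √(r y) • w y) x :=
    (hr.contMDiff_sqrt.smul hw).mdifferentiable (by simp) x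
  have hdr (v : ES) :
      differential IS r x v = 2 * √(r x) * differential IS (fun y => √(r y)) x v := by
    have h := differential_smul hsx hsx v
    simp only [smul_eq_mul, Real.mul_self_sqrt (hr.pos _).le] at h
    rw [h]
    ring
  refine (injective_iff_map_eq_zero (differential IS (fun x => (√(r x), √(r x) • w x)) x)).2
    fun v hv => (injective_iff_map_eq_zero _).1 (himm x) v ?_
  rw [differential_prodMk hsx hswx, differential_smul hsx hwx, Prod.mk_eq_zero] at hv
  obtain ⟨hdsqrt, hdw⟩ := hv
  rw [hdsqrt, zero_smul, add_zero, smul_eq_zero_iff_right (Real.sqrt_pos.2 (hr.pos x)).ne'] at hdw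
  rw [differential_prodMk (hr.contMDiff.mdifferentiable (by simp) x) hwx, hdr, hdsqrt, hdw,
    mul_zero, Prod.mk_zero_zero]

end SmoothCone

end SmoothEmbedding

section ComplexVector

variable {κ : Type*} {n : ℕ} (e : κ ≃ Fin n)

/-- The identification of pairs of real vectors `(p, q)`, indexed by `κ`, with the complex vectors
`p + i q`, the coordinates being enumerated by `e`. -/
noncomputable def complexVector [Fintype κ] :
    ((κ → ℝ) × (κ → ℝ)) ≃L[ℝ] EuclideanSpace ℂ (Fin n) :=
  LinearEquiv.toContinuousLinearEquiv
    { toFun := fun p => WithLp.toLp 2 fun k => ⟨p.1 (e.symm k), p.2 (e.symm k)⟩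
      invFun := fun ζ => (fun j => (ζ (e j)).re, fun j => (ζ (e j)).im)
      map_add' := fun _ _ => rfl
      map_smul' := fun c p => by
        ext k
        apply Complex.ext <;> simp
      left_inv := fun p => by simp
      right_inv := fun ζ => by simp }

variable [Fintype κ]

theorem complexVector_apply (p : (κ → ℝ) × (κ → ℝ)) (k : Fin n) :
    complexVector e p k = ⟨p.1 (e.symm k), p.2 (e.symm k)⟩ := rfl

theorem toEuclideanLin_complexifyRep_complexVector [DecidableEq κ] {G : Type*} [Group G]
    [TopologicalSpace G] {M : G → Matrix κ κ ℝ} (hM : IsOrthogonalMatrixRep M) (g : G)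
    (p q : κ → ℝ) :
    Matrix.toEuclideanLin (complexifyRep (hM.reindex e).toMonoidHom g : Matrix (Fin n) (Fin n) ℂ)
      (complexVector e (p, q)) = complexVector e ((M g).mulVec p, (M g).mulVec q) := by
  ext k
  change ∑ j, (M g (e.symm k) (e.symm j) : ℂ) * (⟨p (e.symm j), q (e.symm j)⟩ : ℂ) = ⟨_, _⟩
  rw [Equiv.sum_comp e.symm fun j => (M g (e.symm k) j : ℂ) * (⟨p j, q j⟩ : ℂ)]
  apply Complex.ext
  · simp [Matrix.mulVec, dotProduct]
  · simp [Matrix.mulVec, dotProduct]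

variable {ES : Type*} [NormedAddCommGroup ES] [NormedSpace ℝ ES]
  {HS : Type*} [TopologicalSpace HS] {IS : ModelWithCorners ℝ ES HS}
  {S : Type*} [TopologicalSpace S] [ChartedSpace HS S] {p q : S → κ → ℝ}

theorem imConjDot_complexVector {x : S} (hp : MDifferentiableAt IS 𝓘(ℝ, κ → ℝ) p x)
    (hq : MDifferentiableAt IS 𝓘(ℝ, κ → ℝ) q x) (v : ES) :
    imConjDot IS (fun y => complexVector e (p y, q y)) x v
      = p x ⬝ᵥ differential IS q x v - q x ⬝ᵥ differential IS p x v := by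
  have hdz : differential IS (fun y => complexVector e (p y, q y)) x v
      = complexVector e (differential IS p x v, differential IS q x v) :=
    (differential_clm_comp (hp.prodMk_space hq) (complexVector e).toContinuousLinearMap v).trans
      (congrArg _ (differential_prodMk hp hq v))
  change (∑ k, starRingEnd ℂ (complexVector e (p x, q x) k)
    * differential IS (fun y => complexVector e (p y, q y)) x v k).im = _
  rw [hdz, Complex.im_sum, dotProduct, dotProduct, ← Finset.sum_sub_distrib,
    ← Equiv.sum_comp e.symm]
  refine Finset.sum_congr rfl fun k _ => ?_
  simp only [complexVector_apply, Complex.mul_im, Complex.conj_re, Complex.conj_im]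
  ring

end ComplexVector

section RealPair

variable {ES : Type*} [NormedAddCommGroup ES] [NormedSpace ℝ ES]
  {HS : Type*} [TopologicalSpace HS] {IS : ModelWithCorners ℝ ES HS}
  {S : Type*} [TopologicalSpace S] [ChartedSpace HS S]
  {ι : Type*} [Fintype ι] {κ : Type*} [Fintype κ]

theorem contMDiff_sumElim {p : S → ι → ℝ} {q : S → κ → ℝ} (hp : ContMDiff IS 𝓘(ℝ, ι → ℝ) ∞ p)
    (hq : ContMDiff IS 𝓘(ℝ, κ → ℝ) ∞ q) :
    ContMDiff IS 𝓘(ℝ, ι ⊕ κ → ℝ) ∞ fun x => Sum.elim (p x) (q x) :=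
  contMDiff_pi_space.2 fun j => j.casesOn (contMDiff_pi_space.1 hp) (contMDiff_pi_space.1 hq)

theorem differential_sumElim {p : S → ι → ℝ} {q : S → κ → ℝ} (hp : ContMDiff IS 𝓘(ℝ, ι → ℝ) ∞ p)
    (hq : ContMDiff IS 𝓘(ℝ, κ → ℝ) ∞ q) (x : S) (v : ES) :
    differential IS (fun y => Sum.elim (p y) (q y)) x v
      = Sum.elim (differential IS p x v) (differential IS q x v) := by
  have hpq := (contMDiff_sumElim hp hq).mdifferentiable (by simp) x
  funext j
  rw [differential_pi_apply hpq]
  cases j with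
  | inl i => exact (differential_pi_apply (hp.mdifferentiable (by simp) x) v i).symm
  | inr k => exact (differential_pi_apply (hq.mdifferentiable (by simp) x) v k).symm

theorem contMDiff_dotProduct {p q : S → ι → ℝ} (hp : ContMDiff IS 𝓘(ℝ, ι → ℝ) ∞ p)
    (hq : ContMDiff IS 𝓘(ℝ, ι → ℝ) ∞ q) : ContMDiff IS 𝓘(ℝ, ℝ) ∞ fun x => p x ⬝ᵥ q x :=
  contMDiff_finsetSum fun i _ => (contMDiff_pi_space.1 hp i).mul (contMDiff_pi_space.1 hq i)

theorem differential_dotProduct {p q : S → ι → ℝ} {x : S}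
    (hp : MDifferentiableAt IS 𝓘(ℝ, ι → ℝ) p x) (hq : MDifferentiableAt IS 𝓘(ℝ, ι → ℝ) q x)
    (v : ES) : differential IS (fun y => p y ⬝ᵥ q y) x v
      = p x ⬝ᵥ differential IS q x v + differential IS p x v ⬝ᵥ q x :=
  differential_bilinear hp hq
    (dotProductBilin ℝ ℝ : (ι → ℝ) →ₗ[ℝ] (ι → ℝ) →ₗ[ℝ] ℝ).toContinuousBilinearMap v

theorem dotProduct_differential_sub_smul {s : S → ℝ} {p q : S → ι → ℝ} {x : S}
    (hs : MDifferentiableAt IS 𝓘(ℝ, ℝ) s x) (hp : MDifferentiableAt IS 𝓘(ℝ, ι → ℝ) p x)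
    (hq : MDifferentiableAt IS 𝓘(ℝ, ι → ℝ) q x) (v : ES) :
    (s x • p x) ⬝ᵥ differential IS (fun y => s y • q y) x v
        - (s x • q x) ⬝ᵥ differential IS (fun y => s y • p y) x v
      = s x ^ 2 * (p x ⬝ᵥ differential IS q x v - q x ⬝ᵥ differential IS p x v) := by
  simp only [differential_smul hs hp, differential_smul hs hq, dotProduct_add, dotProduct_smul,
    smul_dotProduct, smul_eq_mul, dotProduct_comm (q x) (p x)]
  ring

/-- The first member of the pair of maps `U = augmentedCoefficients β`,
`W = augmentedCoordinates β w` such that `U · dW - W · dU = β · dw`. -/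
noncomputable def augmentedCoefficients (β : S → ι → ℝ) (x : S) : ι ⊕ Unit → ℝ :=
  Sum.elim ((1 / 2 : ℝ) • β x) fun _ => 1

/-- The second member of the pair. On the coordinates indexed by `ι` alone one finds
`(β · dw - w · dβ) / 2`; the last coordinate adds the missing `d(β · w) / 2`. -/
noncomputable def augmentedCoordinates (β w : S → ι → ℝ) (x : S) : ι ⊕ Unit → ℝ :=
  Sum.elim (w x) fun _ => (1 / 2 : ℝ) * (β x ⬝ᵥ w x)

theorem contMDiff_augmentedCoefficients {β : S → ι → ℝ} (hβ : ContMDiff IS 𝓘(ℝ, ι → ℝ) ∞ β) :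
    ContMDiff IS 𝓘(ℝ, ι ⊕ Unit → ℝ) ∞ (augmentedCoefficients β) :=
  contMDiff_sumElim ((ContinuousLinearMap.lsmul ℝ ℝ (1 / 2 : ℝ)).contMDiff.comp hβ) contMDiff_const

theorem contMDiff_augmentedCoordinates {β w : S → ι → ℝ} (hβ : ContMDiff IS 𝓘(ℝ, ι → ℝ) ∞ β)
    (hw : ContMDiff IS 𝓘(ℝ, ι → ℝ) ∞ w) :
    ContMDiff IS 𝓘(ℝ, ι ⊕ Unit → ℝ) ∞ (augmentedCoordinates β w) :=
  contMDiff_sumElim hw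
    (contMDiff_pi_space.2 fun _ => contMDiff_const.mul (contMDiff_dotProduct hβ hw))

theorem differential_augmentedCoefficients {β : S → ι → ℝ} (hβ : ContMDiff IS 𝓘(ℝ, ι → ℝ) ∞ β)
    (x : S) (v : ES) : differential IS (augmentedCoefficients β) x v
      = Sum.elim ((1 / 2 : ℝ) • differential IS β x v) 0 := by
  let half : (ι → ℝ) →L[ℝ] ι → ℝ := .lsmul ℝ ℝ (1 / 2 : ℝ)
  refine (differential_sumElim (half.contMDiff.comp hβ) contMDiff_const x v).trans ?_
  rw [differential_const]
  exact congrArg (fun u => (Sum.elim u 0 : ι ⊕ Unit → ℝ))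
    (differential_clm_comp (hβ.mdifferentiable (by simp) x) half v)

theorem differential_augmentedCoordinates {β w : S → ι → ℝ} (hβ : ContMDiff IS 𝓘(ℝ, ι → ℝ) ∞ β)
    (hw : ContMDiff IS 𝓘(ℝ, ι → ℝ) ∞ w) (x : S) (v : ES) :
    differential IS (augmentedCoordinates β w) x v
      = Sum.elim (differential IS w x v) fun _ => (1 / 2 : ℝ) *
        (β x ⬝ᵥ differential IS w x v + differential IS β x v ⬝ᵥ w x) := by
  have hβw := contMDiff_dotProduct hβ hw
  have hlast : ContMDiff IS 𝓘(ℝ, Unit → ℝ) ∞ fun y (_ : Unit) => (1 / 2 : ℝ) * (β y ⬝ᵥ w y) :=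
    contMDiff_pi_space.2 fun _ => contMDiff_const.mul hβw
  refine (differential_sumElim hw hlast x v).trans (congrArg _ (funext fun _ => ?_))
  rw [differential_pi_apply (hlast.mdifferentiable (by simp) x),
    ← differential_dotProduct (hβ.mdifferentiable (by simp) x) (hw.mdifferentiable (by simp) x)]
  exact differential_clm_comp (hβw.mdifferentiable (by simp) x) (.lsmul ℝ ℝ (1 / 2 : ℝ)) v

theorem dotProduct_differential_augmented_sub {β w : S → ι → ℝ}
    (hβ : ContMDiff IS 𝓘(ℝ, ι → ℝ) ∞ β) (hw : ContMDiff IS 𝓘(ℝ, ι → ℝ) ∞ w) (x : S) (v : ES) :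
    augmentedCoefficients β x ⬝ᵥ differential IS (augmentedCoordinates β w) x v
        - augmentedCoordinates β w x ⬝ᵥ differential IS (augmentedCoefficients β) x v
      = β x ⬝ᵥ differential IS w x v := by
  rw [differential_augmentedCoefficients hβ, differential_augmentedCoordinates hβ hw,
    augmentedCoefficients, augmentedCoordinates, sumElim_dotProduct_sumElim,
    sumElim_dotProduct_sumElim, dotProduct_pUnit, dotProduct_zero, smul_dotProduct,
    dotProduct_smul, dotProduct_comm (differential IS β x v), smul_eq_mul, smul_eq_mul]
  ring

omit [TopologicalSpace S] in
theorem augmentedCoefficients_smul {G : Type*} [SMul G S] {M : G → Matrix ι ι ℝ}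
    {β : S → ι → ℝ} {g : G} {x : S} (hβ : β (g • x) = (M g).mulVec (β x)) :
    augmentedCoefficients β (g • x)
      = (Matrix.fromBlocks (M g) 0 0 1).mulVec (augmentedCoefficients β x) := by
  simp [augmentedCoefficients, Matrix.fromBlocks_mulVec, hβ, Matrix.mulVec_smul]

omit [TopologicalSpace S] in
theorem augmentedCoordinates_smul [DecidableEq ι] {G : Type*} [Group G] [TopologicalSpace G]
    [SMul G S] {M : G → Matrix ι ι ℝ} (hM : IsOrthogonalMatrixRep M) {β w : S → ι → ℝ} {g : G}
    {x : S} (hβ : β (g • x) = (M g).mulVec (β x)) (hw : w (g • x) = (M g).mulVec (w x)) :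
    augmentedCoordinates β w (g • x)
      = (Matrix.fromBlocks (M g) 0 0 1).mulVec (augmentedCoordinates β w x) := by
  simp [augmentedCoordinates, Matrix.fromBlocks_mulVec, hβ, hw, hM.dotProduct_mulVec]

end RealPair

namespace SmoothCone

variable {ES : Type*} [NormedAddCommGroup ES] [NormedSpace ℝ ES]
  {HS : Type*} [TopologicalSpace HS] {IS : ModelWithCorners ℝ ES HS}
  {EX : Type*} [NormedAddCommGroup EX] [NormedSpace ℝ EX]
  {HX : Type*} [TopologicalSpace HX] {IX : ModelWithCorners ℝ EX HX}
  {S : Type*} [TopologicalSpace S] [ChartedSpace HS S] [IsManifold IS ∞ S]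
  {X : Type*} [TopologicalSpace X] [ChartedSpace HX X] {C : SmoothCone IS IX S X} {r : S → ℝ}
  {lam : SmoothOneForm IS S} {G : Type*} [Group G] [TopologicalSpace G] [MulAction G S]
  {ι : Type*} [Fintype ι] [DecidableEq ι] {M : G → Matrix ι ι ℝ}

theorem exists_complex_embedding_of_real_pair (hM : IsOrthogonalMatrixRep M) {p q : S → ι → ℝ}
    (hpq : IsSmoothEmbeddingInto IS fun x => (p x, q x))
    (hpM : ∀ g x, p (g • x) = (M g).mulVec (p x)) (hqM : ∀ g x, q (g • x) = (M g).mulVec (q x))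
    (hpdil : ∀ t, 0 < t → ∀ x, p (C.dil t x) = √t • p x)
    (hqdil : ∀ t, 0 < t → ∀ x, q (C.dil t x) = √t • q x)
    (hlam : ∀ x (v : ES), lam x v = p x ⬝ᵥ differential IS q x v - q x ⬝ᵥ differential IS p x v) :
    ∃ (n : ℕ) (rep : G →* Matrix.orthogonalGroup (Fin n) ℝ) (z : S → EuclideanSpace ℂ (Fin n)),
      Continuous rep ∧
      IsSmoothEmbeddingInto IS z ∧
      (∀ (g : G) (x : S),
        z (g • x) = Matrix.toEuclideanLin (complexifyRep rep g : Matrix (Fin n) (Fin n) ℂ) (z x)) ∧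
      (∀ (t : ℝ), 0 < t → ∀ x : S, z (C.dil t x) = Real.sqrt t • z x) ∧
      ∀ (x : S) (v : TangentSpace IS x), lam x v = imConjDot IS z x v := by
  let e := Fintype.equivFin ι
  have hp : ContMDiff IS 𝓘(ℝ, ι → ℝ) ∞ p := contDiff_fst.contMDiff.comp hpq.1
  have hq : ContMDiff IS 𝓘(ℝ, ι → ℝ) ∞ q := contDiff_snd.contMDiff.comp hpq.1
  refine ⟨Fintype.card ι, (hM.reindex e).toMonoidHom, fun x => complexVector e (p x, q x),
    (hM.reindex e).continuous_toMonoidHom, ?_, fun g x => ?_, fun t ht x => ?_, fun x v => ?_⟩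
  · refine isSmoothEmbeddingInto_of_clm_comp
      ((complexVector e).toContinuousLinearMap.contMDiff.comp hpq.1)
      (complexVector e).symm.toContinuousLinearMap ?_
    simpa using hpq
  · simp only [hpM, hqM]
    exact (toEuclideanLin_complexifyRep_complexVector e hM g (p x) (q x)).symm
  · simp only [hpdil t ht, hqdil t ht, ← map_smul, Prod.smul_mk]
  · exact (hlam x v).trans (imConjDot_complexVector e (hp.mdifferentiable (by simp) x)
      (hq.mdifferentiable (by simp) x) v).symm

theorem IsRadius.exists_real_pair [CompactSpace X] [T2Space X] (hr : C.IsRadius r)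
    (hrG : ∀ (g : G) x, r (g • x) = r x) (hM : IsOrthogonalMatrixRep M) {β w : S → ι → ℝ}
    (hw : ContMDiff IS 𝓘(ℝ, ι → ℝ) ∞ w) (hwM : ∀ g x, w (g • x) = (M g).mulVec (w x))
    (hw0 : C.IsDegreeZero w) (hinj : Function.Injective fun x => (r x, w x))
    (himm : ∀ x, Function.Injective (differential IS (fun x => (r x, w x)) x))
    (hβ : ContMDiff IS 𝓘(ℝ, ι → ℝ) ∞ β) (hβM : ∀ g x, β (g • x) = (M g).mulVec (β x))
    (hβ0 : C.IsDegreeZero β)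
    (hlam : ∀ x (v : ES), lam x v = r x * (β x ⬝ᵥ differential IS w x v)) :
    ∃ p q : S → ι ⊕ Unit → ℝ, IsSmoothEmbeddingInto IS (fun x => (p x, q x)) ∧
      (∀ g x, p (g • x) = (Matrix.fromBlocks (M g) 0 0 1).mulVec (p x)) ∧
      (∀ g x, q (g • x) = (Matrix.fromBlocks (M g) 0 0 1).mulVec (q x)) ∧
      (∀ t, 0 < t → ∀ x, p (C.dil t x) = √t • p x) ∧
      (∀ t, 0 < t → ∀ x, q (C.dil t x) = √t • q x) ∧
      ∀ x (v : ES), lam x v = p x ⬝ᵥ differential IS q x v - q x ⬝ᵥ differential IS p x v := by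
  have hU := contMDiff_augmentedCoefficients hβ
  have hW := contMDiff_augmentedCoordinates hβ hw
  have hsqrt_dil (t : ℝ) (ht : 0 < t) (x : S) : √(r (C.dil t x)) = √t * √(r x) := by
    rw [hr.map_dil t ht, Real.sqrt_mul ht.le]
  refine ⟨fun x => √(r x) • augmentedCoefficients β x,
    fun x => √(r x) • augmentedCoordinates β w x, ?_, fun g x => ?_, fun g x => ?_,
    fun t ht x => ?_, fun t ht x => ?_, fun x v => ?_⟩
  · let L : ((ι ⊕ Unit → ℝ) × (ι ⊕ Unit → ℝ)) →L[ℝ] ℝ × (ι → ℝ) :=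
      (ContinuousLinearMap.proj (Sum.inr ())).prodMap
        (.pi fun i => .proj (Sum.inl i))
    refine isSmoothEmbeddingInto_of_clm_comp ((hr.contMDiff_sqrt.smul hU).prodMk_space
      (hr.contMDiff_sqrt.smul hW)) L ?_
    convert hr.isSmoothEmbeddingInto_sqrt_smul hw hw0 hinj himm using 1
    funext x
    exact Prod.ext (mul_one _) rfl
  · simp only [hrG, augmentedCoefficients_smul (hβM g x), Matrix.mulVec_smul]
  · simp only [hrG, augmentedCoordinates_smul hM (hβM g x) (hwM g x), Matrix.mulVec_smul]
  · simp only [hsqrt_dil t ht, mul_smul, augmentedCoefficients, hβ0 t ht]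
  · simp only [hsqrt_dil t ht, mul_smul, augmentedCoordinates, hβ0 t ht, hw0 t ht]
  · simp only [dotProduct_differential_sub_smul (hr.contMDiff_sqrt.mdifferentiable (by simp) x)
      (hU.mdifferentiable (by simp) x) (hW.mdifferentiable (by simp) x),
      dotProduct_differential_augmented_sub hβ hw, Real.sq_sqrt (hr.pos x).le, hlam]

end SmoothCone

section InvariantRadius

open MeasureTheory

variable {EG : Type*} [NormedAddCommGroup EG] [NormedSpace ℝ EG]
  {G : Type*} [Group G] [TopologicalSpace G] [ChartedSpace EG G] [LieGroup 𝓘(ℝ, EG) ∞ G]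
  [MeasurableSpace G] [BorelSpace G] {μ : Measure G}
  {ES : Type*} [NormedAddCommGroup ES] [NormedSpace ℝ ES]
  {HS : Type*} [TopologicalSpace HS] {IS : ModelWithCorners ℝ ES HS} {S : Type*} [MulAction G S]

theorem orbitIntegral_one_smul [ContinuousMul G] [μ.IsMulLeftInvariant] (f : S → ℝ) (h : G)
    (x : S) : orbitIntegral μ (fun _ => 1) f (h • x) = orbitIntegral μ (fun _ => 1) f x := by
  rw [orbitIntegral, orbitIntegral,
    ← integral_mul_left_eq_self (fun g => (1 : ℝ) • f (g⁻¹ • h • x)) h]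
  simp only [mul_inv_rev, mul_smul, inv_smul_smul]

variable [TopologicalSpace S] [ChartedSpace HS S] [ContMDiffSMul 𝓘(ℝ, EG) IS ∞ G S]
  [CompactSpace G]

include EG in
variable (EG) in
theorem orbitIntegral_one_pos [IsFiniteMeasure μ] [μ.IsOpenPosMeasure] {f : S → ℝ}
    (hf : ContMDiff IS 𝓘(ℝ, ℝ) ∞ f) (hpos : ∀ x, 0 < f x) (x : S) :
    0 < orbitIntegral μ (fun _ => 1) f x := by
  have hc : Continuous fun g : G => f (g⁻¹ • x) := (orbitMap EG G hf x).continuous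
  simp only [orbitIntegral, one_smul]
  exact hc.integral_pos_of_hasCompactSupport_nonneg_nonzero
    (HasCompactSupport.of_compactSpace _) (fun g => (hpos _).le) (hpos ((1 : G)⁻¹ • x)).ne'

variable [FiniteDimensional ℝ ES] [IsManifold IS ∞ S] [SecondCountableTopology G]
  {EX : Type*} [NormedAddCommGroup EX] [NormedSpace ℝ EX] [FiniteDimensional ℝ EX]
  {HX : Type*} [TopologicalSpace HX] {IX : ModelWithCorners ℝ EX HX}
  {X : Type*} [TopologicalSpace X] [ChartedSpace HX X] [IsManifold IX ∞ X] [T2Space X]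
  [CompactSpace X]

include EG in
variable (EG μ) in
theorem SmoothCone.exists_invariant_isRadius (C : SmoothCone IS IX S X) [ContinuousMul G]
    [IsFiniteMeasure μ] [μ.IsOpenPosMeasure] [μ.IsMulLeftInvariant]
    (hcomm : ∀ (g : G) (t : ℝ), 0 < t → ∀ x : S, g • C.dil t x = C.dil t (g • x)) :
    ∃ r, C.IsRadius r ∧ ∀ (g : G) x, r (g • x) = r x := by
  obtain ⟨r, hr⟩ := C.exists_isRadius
  refine ⟨orbitIntegral μ (fun _ => 1) r,
    ⟨contMDiff_orbitIntegral EG (integrable_const 1) hr.contMDiff,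
      orbitIntegral_one_pos EG hr.contMDiff hr.pos, fun t ht x => ?_⟩, orbitIntegral_one_smul r⟩
  simp only [orbitIntegral, one_smul, hcomm _ t ht, hr.map_dil t ht, integral_const_mul]

end InvariantRadius

theorem mainTheorem10
    -- a compact Lie group `G`
    {EG : Type*} [NormedAddCommGroup EG] [NormedSpace ℝ EG] [FiniteDimensional ℝ EG]
    {G : Type*} [Group G] [TopologicalSpace G] [ChartedSpace EG G] [LieGroup 𝓘(ℝ, EG) ∞ G]
    [T2Space G] [CompactSpace G]
    -- a finite-dimensional smooth manifold `S` (the total space of the cone)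
    {ES : Type*} [NormedAddCommGroup ES] [NormedSpace ℝ ES] [FiniteDimensional ℝ ES]
    {HS : Type*} [TopologicalSpace HS] (IS : ModelWithCorners ℝ ES HS)
    {S : Type*} [TopologicalSpace S] [ChartedSpace HS S] [IsManifold IS ∞ S] [T2Space S]
    -- a finite-dimensional compact smooth manifold `X` (the base of the cone)
    {EX : Type*} [NormedAddCommGroup EX] [NormedSpace ℝ EX] [FiniteDimensional ℝ EX]
    {HX : Type*} [TopologicalSpace HX] (IX : ModelWithCorners ℝ EX HX)
    {X : Type*} [TopologicalSpace X] [ChartedSpace HX X] [IsManifold IX ∞ X] [T2Space X]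
    [CompactSpace X]
    -- a `G`-cone: `G` acts smoothly on the cone and commutes with homotheties
    (C : SmoothCone IS IX S X)
    [MulAction G S] [ContMDiffSMul 𝓘(ℝ, EG) IS ∞ G S]
    (hcomm : ∀ (g : G) (t : ℝ), 0 < t → ∀ x : S, g • C.dil t x = C.dil t (g • x))
    -- a `G`-invariant horizontal 1-form, homogeneous of degree 1
    (lam : SmoothOneForm IS S)
    (hinv : ∀ (g : G) (x : S) (v : TangentSpace IS x),
      pullbackOneForm (fun y : S => g • y) lam x v = lam x v)
    (hhor : C.IsHorizontal lam)
    (hhom : C.HasRadialLieDeriv lam lam) :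
    ∃ (n : ℕ) (rep : G →* Matrix.orthogonalGroup (Fin n) ℝ) (z : S → EuclideanSpace ℂ (Fin n)),
      Continuous rep ∧
      IsSmoothEmbeddingInto IS z ∧
      (∀ (g : G) (x : S),
        z (g • x) = Matrix.toEuclideanLin (complexifyRep rep g : Matrix (Fin n) (Fin n) ℂ) (z x)) ∧
      (∀ (t : ℝ), 0 < t → ∀ x : S, z (C.dil t x) = Real.sqrt t • z x) ∧
      ∀ (x : S) (v : TangentSpace IS x), lam x v = imConjDot IS z x v := by
  let : MeasurableSpace G := borel G
  have : BorelSpace G := ⟨rfl⟩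
  have : IsTopologicalGroup G := topologicalGroup_of_lieGroup 𝓘(ℝ, EG) ∞
  have : SecondCountableTopology G := ChartedSpace.secondCountable_of_sigmaCompact EG G
  have : SigmaCompactSpace S := C.sigmaCompactSpace
  let μ : MeasureTheory.Measure G := MeasureTheory.Measure.haarMeasure ⊤
  have : MeasureTheory.IsProbabilityMeasure μ :=
    ⟨MeasureTheory.Measure.haarMeasure_self (K₀ := ⊤)⟩
  obtain ⟨r, hr, hrG⟩ := C.exists_invariant_isRadius EG μ hcomm
  obtain ⟨d, N, M, w, hM, hw, hwM, hw0, hinj, himm⟩ :=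
    hr.exists_equivariant_injective_immersion EG μ hrG hcomm
  obtain ⟨β, hβ, hβM, hβ0, hlam⟩ :=
    hr.exists_equivariant_coefficients EG μ hrG hcomm hM hw hwM hw0 himm hinv hhor hhom
  obtain ⟨p, q, hpq, hpM, hqM, hpdil, hqdil, hlampq⟩ :=
    hr.exists_real_pair hrG hM hw hwM hw0 hinj himm hβ hβM hβ0 hlam
  exact SmoothCone.exists_complex_embedding_of_real_pair (hM.fromBlocks_one Unit) hpq hpM hqM hpdil
    hqdil hlampq
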